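/- Let $R$ be a connected (finite-dimensional real) Lie group with solvable Lie algebra $\mathfrak{r}$, let $F \subseteq R$ be a non-empty, relatively compact subset that is symmetric ($F = F^{-1}$), and let $(\pi, V)$ be a continuous representation of $R$ on a real vector space $V$ of finite dimension $d$. Let $$\overline{\pi}(g) := \det\big(\pi(g)\big)^{-1/d}\,\pi(g) \qquad (g \in R)$$ be the representation rescaled to have determinant $1$ (for $d = 0$, $\overline{\pi} := \pi$); here $\det(\pi(g)) > 0$ because $R$ is connected. Let $\Lambda$ be a Lebesgue measure on $V$, and for a relatively compact open neighbourhood $U \subseteq V$ of $0$ set $$\delta_F^{\overline{\pi}}(U) := \frac{\Lambda\big(\bigcap_{g \in F} \overline{\pi}(g)(U)\big)}{\Lambda(U)}.$$ A set $U \subseteq V$ is called balanced if $\alpha U \subseteq U$ for all real $\alpha$ with $|\alpha| \leq 1$. For a neighbourhood basis $\mathcal{V}$ of $0 \in V$ consisting of balanced, relatively compact open sets, set $$\delta_F^{\overline{\pi}}(\mathcal{V}) := \liminf_{U \in \mathcal{V}} \delta_F^{\overline{\pi}}(U),$$ the limit inferior being taken as $U \in \mathcal{V}$ shrinks to $0$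 (that is, along $\mathcal{V}$ directed by reverse inclusion), and let $$\overline{\delta}{}_F^V := \sup_{\mathcal{V}} \delta_F^{\overline{\pi}}(\mathcal{V}),$$ the supremum being over all such neighbourhood bases. Then $$\overline{\delta}{}_F^V = 1.$$ (If the intersection $\bigcap_{g \in F} \overline{\pi}(g)(U)$ is not measurable, $\Lambda$ denotes the outer measure.) -/

import Mathlib

open Set Filter Topology MeasureTheory
open scoped Pointwise Manifold ContDiff ENNReal

/-- Over `ℝ`, `minSmoothness ℝ n` is just `n`. This lets a smooth real Lie group carry Mathlib's
Lie algebra structure on its tangent space at the identity. -/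
instance instLEInftyMinSmoothnessReal (n : ℕ∞ω) [h : ENat.LEInfty n] :
    ENat.LEInfty (minSmoothness ℝ n) :=
  ⟨by simpa using h.out⟩

noncomputable section

namespace LocalDeLeeuw

variable {G V : Type*} [NormedAddCommGroup V] [NormedSpace ℝ V]

/-- `δ_F(U) = Λ(⋂_{g ∈ F} ρ(g)(U)) / Λ(U)`, where `Λ` is a Lebesgue measure on `V`. -/
def deltaSet [MeasurableSpace V] (Λ : Measure V) (ρ : G → V →ₗ[ℝ] V) (F : Set G) (U : Set V) :
    ℝ≥0∞ :=
  Λ (⋂ g ∈ F, ρ g '' U) / Λ U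

/-- `δ_F(𝒱) = liminf_{U ∈ 𝒱} δ_F(U)`: the limit inferior over the members `U` of the neighbourhood
basis `𝒱` of `0` as `U` shrinks to `0`. -/
def deltaBasis [MeasurableSpace V] (Λ : Measure V) (ρ : G → V →ₗ[ℝ] V) (F : Set G)
    (𝒱 : Set (Set V)) : ℝ≥0∞ :=
  liminf (deltaSet Λ ρ F) ((𝓝 (0 : V)).smallSets ⊓ 𝓟 𝒱)

/-- `𝒱` is a neighbourhood basis of `0 ∈ V` consisting of balanced, relatively compact, open
sets. -/
structure IsBalancedOpenBasis (𝒱 : Set (Set V)) : Prop where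
  hasBasis : (𝓝 (0 : V)).HasBasis (fun U : Set V => U ∈ 𝒱) id
  isOpen : ∀ U ∈ 𝒱, IsOpen U
  isCompact_closure : ∀ U ∈ 𝒱, IsCompact (closure U)
  balanced : ∀ U ∈ 𝒱, Balanced ℝ U

/-- The rescaled representation `π̄(g) = det(π(g))^(-1/d) π(g)` with `d = dim V`; used when all
determinants are positive, so that `π̄` is again a representation, of determinant one. -/
def rescaled [Monoid G] (π : Representation ℝ G V) (g : G) : V →ₗ[ℝ] V :=
  (LinearMap.det (π g) ^ (-(1 / (Module.finrank ℝ V : ℝ)))) • π g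

/-- `δ̄_F^V`: the supremum of `δ_F(𝒱)`, formed with the rescaled representation `π̄`, over all
neighbourhood bases `𝒱` of `0 ∈ V` consisting of balanced, relatively compact, open sets. -/
def deltaBar [Monoid G] [MeasurableSpace V] (Λ : Measure V) (π : Representation ℝ G V)
    (F : Set G) : ℝ≥0∞ :=
  ⨆ (𝒱 : Set (Set V)) (_ : IsBalancedOpenBasis 𝒱), deltaBasis Λ (rescaled π) F 𝒱

end LocalDeLeeuw

end

/-! Since `rescaled π g` has determinant 1, every translate of U has the volume of U, so each ratio
is at most 1. Dilates of one bounded balanced open U form a neighbourhood basis and have ratios no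
smaller than that of U. So it suffices to find, for each c < 1, one U whose intersection of
translates over F has volume at least c² Λ(U).

Lie's theorem gives every nonzero representation a nonzero invariant subspace, of dimension 1 or 2,
on which the group acts by positive scalars times isometries. Since π is only continuous, it is
first shown to be smooth. Its derivative at 1 is a Lie algebra representation, and a complex
eigenline of the derivative is transported to the group by a linear ODE and connectedness
(`exists_conformal_subspace`).

Induction over quotients then makes the operators block triangular with conformal diagonal blocks.
Shrinking the blocks relative to each other makes the off-diagonal parts arbitrarily small uniformly
on F. Only the conjugation T depends on the precision: D, O and a stay fixed (`ConformalApprox`).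

The model group generated by scalars on blocks is abelian, hence of polynomial growth. A Følner
argument applies to the tubes {x | ‖D t x‖ < r for some |t| ≤ N}: isometries preserve them, D (a g)
enlarges N by a bounded amount, and their volume grows polynomially in N. Hence some tube fills
almost all of its enlargement (`exists_measure_tube_add_le`), and pulling the enlargement back by T
gives U (`exists_nearly_invariant`). -/

/-! ### Continuous homomorphisms into Banach algebras are smooth. -/

section smooth

variable {E : Type*} [NormedAddCommGroup E] [NormedSpace ℝ E]
    {R : Type*} [TopologicalSpace R] [ChartedSpace E R]

/-- This is a convolution with a parameter, evaluated at the constant point 0 with the reflected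
kernel `k p (-y)`. -/
theorem contDiffOn_integral_kernel {A : Type*} [NormedAddCommGroup A] [NormedSpace ℝ A]
    [MeasurableSpace E] [BorelSpace E] {ν : Measure E} {f : E → A} (hf : LocallyIntegrable f ν)
    {k : E → E → ℝ} {s K : Set E} (hs : IsOpen s) (hK : IsCompact K)
    (hk : ∀ p y, p ∈ s → y ∉ K → k p y = 0)
    (hks : ContDiffOn ℝ ∞ (fun q : E × E => k q.1 q.2) (s ×ˢ univ)) :
    ContDiffOn ℝ ∞ (fun p => ∫ y, k p y • f y ∂ν) s := by
  have h := contDiffOn_convolution_right_with_param_comp (𝕜 := ℝ) (n := ⊤) (μ := ν)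
    (ContinuousLinearMap.flip (ContinuousLinearMap.lsmul ℝ ℝ : ℝ →L[ℝ] A →L[ℝ] A))
    (v := fun _ : E => (0 : E)) (s := s) contDiffOn_const (f := f)
    (g := fun p y => k p (-y)) (k := -K) hs hK.neg
    (fun p x hp hx => hk p _ hp (by simpa using hx)) hf ?_
  · simpa [MeasureTheory.convolution] using h
  · have : ContDiff ℝ ∞ (fun q : E × E => ((q.1, -q.2) : E × E)) := by fun_prop
    exact hks.comp this.contDiffOn (fun q hq => ⟨hq.1, mem_univ _⟩)

variable [Group R] [LieGroup 𝓘(ℝ, E) ∞ R]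
  {A : Type*} [NormedRing A] [NormedAlgebra ℝ A]

/-- Inside the chart target the kernel is a composite of smooth maps. Extension by zero stays smooth
because the kernel vanishes off the image of K, which is compact and hence closed in the model
space. -/
theorem contDiffOn_kernel_inv_mul [T2Space R] {φ : R → ℝ} (hφ : ContMDiff 𝓘(ℝ, E) 𝓘(ℝ, ℝ) ∞ φ)
    {N K : Set R} (hN : IsOpen N) (hK : IsCompact K) (hKs : K ⊆ (chartAt E (1 : R)).source)
    (hNK : ∀ a ∈ N, ∀ b, φ (a⁻¹ * b) ≠ 0 → b ∈ K) :
    ContDiffOn ℝ ∞ (fun q : E × E => indicator (chartAt E (1 : R)).target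
      (fun y => φ (((chartAt E (1 : R)).symm q.1)⁻¹ * (chartAt E (1 : R)).symm y)) q.2)
      (((chartAt E (1 : R)).target ∩ (chartAt E (1 : R)).symm ⁻¹' N) ×ˢ univ) := by
  set c := chartAt E (1 : R)
  have hcK : IsClosed (c '' K) := (hK.image_of_continuousOn (c.continuousOn.mono hKs)).isClosed
  have hs : IsOpen (c.target ∩ c.symm ⁻¹' N) := c.isOpen_inter_preimage_symm hN
  rintro ⟨p, y⟩ ⟨hp, -⟩
  apply ContDiffAt.contDiffWithinAt
  by_cases hy : y ∈ c.target
  · have h1 : ContMDiffAt 𝓘(ℝ, E × E) 𝓘(ℝ, E) ∞ (fun q : E × E => c.symm q.1) (p, y) := by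
      have := (contMDiffOn_chart_symm (I := 𝓘(ℝ, E)) (n := ∞) (x := (1 : R))).contMDiffAt
        (c.open_target.mem_nhds hp.1)
      exact ContMDiffAt.comp (p, y) this contDiff_fst.contMDiff.contMDiffAt
    have h2 : ContMDiffAt 𝓘(ℝ, E × E) 𝓘(ℝ, E) ∞ (fun q : E × E => c.symm q.2) (p, y) := by
      have := (contMDiffOn_chart_symm (I := 𝓘(ℝ, E)) (n := ∞) (x := (1 : R))).contMDiffAt
        (c.open_target.mem_nhds hy)
      exact ContMDiffAt.comp (p, y) this contDiff_snd.contMDiff.contMDiffAt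
    have h3 := (hφ.contMDiffAt.comp (p, y) (h1.inv.mul h2)).contDiffAt
    refine h3.congr_of_eventuallyEq ?_
    filter_upwards [(continuous_snd.tendsto (p, y)).eventually (c.open_target.mem_nhds hy)]
      with q hq
    simp [indicator_of_mem hq]
  · have hyK : y ∉ c '' K := by
      rintro ⟨b, hb, rfl⟩
      exact hy (c.map_source (hKs hb))
    refine (contDiffAt_const (c := (0 : ℝ))).congr_of_eventuallyEq ?_
    filter_upwards [(continuous_snd.tendsto (p, y)).eventually (hcK.isOpen_compl.mem_nhds hyK),
      (continuous_fst.tendsto (p, y)).eventually (hs.mem_nhds hp)] with q hq hq1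
    by_cases hqt : q.2 ∈ c.target
    · rw [indicator_of_mem hqt]
      by_contra hne
      exact hq ⟨_, hNK _ hq1.2 _ hne, c.right_inv hqt⟩
    · rw [indicator_of_notMem hqt]

/-- The variable h enters only through φ, so f need only be continuous. Pushing the measure on K
forward by the chart reduces to an integral over the model space. -/
theorem contMDiffAt_integral_inv_mul [FiniteDimensional ℝ E] [T2Space R] [MeasurableSpace R]
    [BorelSpace R]
    {μ : Measure R} [IsFiniteMeasureOnCompacts μ]
    {φ : R → ℝ} (hφ : ContMDiff 𝓘(ℝ, E) 𝓘(ℝ, ℝ) ∞ φ)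
    {N K : Set R} (hN : IsOpen N) (hK : IsCompact K) (hKs : K ⊆ (chartAt E (1 : R)).source)
    (hNK : ∀ a ∈ N, ∀ b, φ (a⁻¹ * b) ≠ 0 → b ∈ K) (h1 : (1 : R) ∈ N)
    {f : R → A} (hf : Continuous f) :
    ContMDiffAt 𝓘(ℝ, E) 𝓘(ℝ, A) ∞ (fun h => ∫ g, φ (h⁻¹ * g) • f g ∂μ) 1 := by
  have hker := contDiffOn_kernel_inv_mul hφ hN hK hKs hNK
  set c := chartAt E (1 : R) with hc
  have hcK : IsCompact (c '' K) := hK.image_of_continuousOn (c.continuousOn.mono hKs)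
  have hs : IsOpen (c.target ∩ c.symm ⁻¹' N) := c.isOpen_inter_preimage_symm hN
  have hKt : c '' K ⊆ c.target := by
    rintro _ ⟨b, hb, rfl⟩
    exact c.map_source (hKs hb)
  classical
  let _ : MeasurableSpace E := borel E
  have : BorelSpace E := ⟨rfl⟩
  have hmeas : AEMeasurable c (μ.restrict K) :=
    (c.continuousOn.mono hKs).aemeasurable hK.measurableSet
  have : IsFiniteMeasure (μ.restrict K) := ⟨by simpa using hK.measure_lt_top⟩
  set ν : Measure E := (μ.restrict K).map c with hν
  have hfc : ContinuousOn (fun y => f (c.symm y)) (c '' K) :=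
    hf.comp_continuousOn (c.continuousOn_symm.mono hKt)
  have hint : Integrable (indicator (c '' K) (fun y => f (c.symm y))) ν :=
    (integrable_indicator_iff hcK.measurableSet).2 (hfc.integrableOn_compact hcK)
  have key := contDiffOn_integral_kernel hint.locallyIntegrable hs hcK
    (k := fun p => indicator c.target (fun y => φ ((c.symm p)⁻¹ * c.symm y))) ?_ hker
  · have h1c : c 1 ∈ c.target ∩ c.symm ⁻¹' N :=
      ⟨c.map_source (mem_chart_source E 1), by
        simpa [c.left_inv (mem_chart_source E (1 : R))] using h1⟩
    have hd := (key.contDiffAt (hs.mem_nhds h1c)).contMDiffAt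
    have hcs : ContMDiffAt 𝓘(ℝ, E) 𝓘(ℝ, E) ∞ c 1 :=
      (contMDiffOn_chart (x := (1 : R))).contMDiffAt
        (c.open_source.mem_nhds (mem_chart_source E 1))
    have := ContMDiffAt.comp (1 : R) hd hcs
    refine this.congr_of_eventuallyEq ?_
    filter_upwards [c.open_source.mem_nhds (mem_chart_source E 1), hN.mem_nhds h1] with h hhs hhN
    rw [Function.comp_apply, hν, integral_map hmeas, ← setIntegral_eq_integral_of_forall_compl_eq_zero (s := K)]
    · refine setIntegral_congr_fun hK.measurableSet fun g hg => ?_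
      rw [indicator_of_mem (c.map_source (hKs hg)), indicator_of_mem (mem_image_of_mem _ hg),
        c.left_inv (hKs hg), c.left_inv hhs]
    · intro g hg
      have : φ (h⁻¹ * g) = 0 := by
        by_contra hne
        exact hg (hNK _ hhN _ hne)
      rw [this, zero_smul]
    · refine AEStronglyMeasurable.smul ?_ hint.aestronglyMeasurable
      have hcont : Continuous fun g : R => φ (h⁻¹ * g) := by
        have := topologicalGroup_of_lieGroup 𝓘(ℝ, E) ∞ (G := R)
        exact hφ.continuous.comp (continuous_const.mul continuous_id)
      rw [← c.left_inv hhs] at hcont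
      refine AEMeasurable.aestronglyMeasurable ?_
      exact ((hcont.comp_continuousOn c.continuousOn_symm).measurable_piecewise
        continuousOn_const c.open_target.measurableSet).aemeasurable
  · intro p y hp hy
    by_cases hyt : y ∈ c.target
    · rw [indicator_of_mem hyt]
      by_contra hne
      exact hy ⟨_, hNK _ hp.2 _ hne, c.right_inv hyt⟩
    · rw [indicator_of_notMem hyt]

/-- A continuous homomorphism from a Lie group to the multiplicative monoid of a Banach algebra
is smooth. -/
theorem contMDiff_of_continuous_monoidHom [FiniteDimensional ℝ E] [CompleteSpace A]
    (π : R →* A) (hπ : Continuous π) :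
    ContMDiff 𝓘(ℝ, E) 𝓘(ℝ, A) ∞ π := by
  have := topologicalGroup_of_lieGroup 𝓘(ℝ, E) ∞ (G := R)
  have : T1Space R := ChartedSpace.t1Space E R
  have : LocallyCompactSpace R := ChartedSpace.locallyCompactSpace E R
  let _ : MeasurableSpace R := borel R
  have : BorelSpace R := ⟨rfl⟩
  -- Translation: π h = π g · π (g⁻¹h), so smoothness at 1 gives smoothness at g.
  suffices h1 : ContMDiffAt 𝓘(ℝ, E) 𝓘(ℝ, A) ∞ π 1 by
    intro g
    have e : (π : R → A) = fun h => π g * π (g⁻¹ * h) := by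
      ext h
      rw [← map_mul, mul_inv_cancel_left]
    rw [e]
    have h2 : ContMDiffAt 𝓘(ℝ, E) 𝓘(ℝ, E) ∞ (fun h => g⁻¹ * h) g := contMDiffAt_mul_left
    have h3 : ContMDiffAt 𝓘(ℝ, E) 𝓘(ℝ, A) ∞ π (g⁻¹ * g) := by rwa [inv_mul_cancel]
    have h4 := ContMDiffAt.comp g h3 h2
    have h5 : ContDiff ℝ ∞ fun a : A => π g * a := by fun_prop
    exact h5.contMDiff.contMDiffAt.comp g h4
  let μ : Measure R := Measure.haar
  obtain ⟨K, hK1, hKs, hK⟩ := LocallyCompactSpace.local_compact_nhds (1 : R) _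
    ((chartAt E (1 : R)).open_source.mem_nhds (mem_chart_source E 1))
  obtain ⟨N, hN, hN1, hNK⟩ := exists_open_nhds_one_mul_subset hK1
  have hS : N ∩ {g | ‖π g - 1‖ < 1 / 2} ∈ 𝓝 (1 : R) := by
    refine inter_mem (hN.mem_nhds hN1) ?_
    have : IsOpen {g | ‖π g - 1‖ < 1 / 2} :=
      isOpen_lt (hπ.sub continuous_const).norm continuous_const
    exact this.mem_nhds (by simp)
  -- The bump lives where π is within 1/2 of 1, so its normalised average `B⁻¹ • a` is also that
  -- close to 1 and is invertible.
  obtain ⟨φ, -, hφS⟩ := (SmoothBumpFunction.nhds_basis_tsupport (I := 𝓘(ℝ, E)) (1 : R)).mem_iff.1 hS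
  have hφc : Continuous φ := φ.continuous
  have hφi : Integrable φ μ := hφc.integrable_of_hasCompactSupport φ.hasCompactSupport
  have hφπi : Integrable (fun g => φ g • π g) μ :=
    (hφc.smul hπ).integrable_of_hasCompactSupport φ.hasCompactSupport.smul_right
  have hB : 0 < ∫ g, φ g ∂μ :=
    hφc.integral_pos_of_hasCompactSupport_nonneg_nonzero φ.hasCompactSupport
      (fun g => φ.nonneg) (x := 1) (by simp)
  set B := ∫ g, φ g ∂μ with hBdef
  set a := ∫ g, φ g • π g ∂μ with ha
  have hau : IsUnit (B⁻¹ • a) := by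
    have h1 : 1 - B⁻¹ • a = B⁻¹ • ∫ g, φ g • (1 - π g) ∂μ := by
      simp_rw [smul_sub]
      rw [integral_sub (hφi.smul_const _) hφπi, integral_smul_const, smul_sub, smul_smul,
        inv_mul_cancel₀ hB.ne', one_smul]
    have h2 : ‖∫ g, φ g • (1 - π g) ∂μ‖ ≤ ∫ g, φ g * (1 / 2) ∂μ := by
      refine norm_integral_le_of_norm_le (hφi.mul_const _) (Eventually.of_forall fun g => ?_)
      rw [norm_smul, Real.norm_of_nonneg φ.nonneg]
      by_cases hg : φ g = 0
      · simp [hg]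
      · refine mul_le_mul_of_nonneg_left ?_ φ.nonneg
        rw [norm_sub_rev]
        exact (hφS (subset_tsupport _ hg)).2.le
    have h3 : ‖1 - B⁻¹ • a‖ < 1 := by
      rw [h1, norm_smul, norm_inv, Real.norm_of_nonneg hB.le]
      rw [integral_mul_const, ← hBdef] at h2
      calc B⁻¹ * ‖∫ g, φ g • (1 - π g) ∂μ‖ ≤ B⁻¹ * (B * (1 / 2)) := by gcongr
        _ = 1 / 2 := by field_simp
        _ < 1 := by norm_num
    simpa using isUnit_one_sub_of_norm_lt_one h3
  obtain ⟨u, hu⟩ := hau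
  have hsm := contMDiffAt_integral_inv_mul (μ := μ) φ.contMDiff hN hK hKs
    (fun b hb g hg => by
      have := hNK (Set.mul_mem_mul hb (hφS (subset_tsupport _ hg)).1)
      rwa [mul_inv_cancel_left] at this) hN1 hπ
  -- Left invariance of Haar measure turns the smoothed integral into π h · a; dividing by the unit
  -- a expresses π through a smooth function.
  have e : (π : R → A) = fun h => (∫ g, φ (h⁻¹ * g) • π g ∂μ) * (B⁻¹ • (↑u⁻¹ : A)) := by
    ext h
    have h1 : ∫ g, φ (h⁻¹ * g) • π g ∂μ = π h * a := by
      rw [← integral_mul_left_eq_self _ h, ha, ← integral_const_mul_of_integrable hφπi]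
      refine integral_congr_ae (Eventually.of_forall fun g => ?_)
      simp
    rw [h1, mul_smul_comm, ← smul_mul_assoc, ← mul_smul_comm, ← hu, mul_assoc, Units.mul_inv,
      mul_one]
  rw [e]
  have h5 : ContDiff ℝ ∞ fun b : A => b * (B⁻¹ • (↑u⁻¹ : A)) := by fun_prop
  exact h5.contMDiff.contMDiffAt.comp 1 hsm

end smooth

/-! ### The derivative at the identity is a Lie algebra homomorphism. -/

section differential

open VectorField

/-- The second-derivative terms of V(Wf) − W(Vf) cancel by symmetry. -/
theorem fderiv_apply_lieBracket {E F : Type*} [NormedAddCommGroup E] [NormedSpace ℝ E]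
    [NormedAddCommGroup F] [NormedSpace ℝ F] {f : E → F} {x : E} (hf : ContDiffAt ℝ 2 f x)
    {V W : E → E} (hV : DifferentiableAt ℝ V x) (hW : DifferentiableAt ℝ W x) :
    fderiv ℝ f x (lieBracket ℝ V W x) =
      fderiv ℝ (fun y => fderiv ℝ f y (W y)) x (V x) -
        fderiv ℝ (fun y => fderiv ℝ f y (V y)) x (W x) := by
  have hd : DifferentiableAt ℝ (fderiv ℝ f) x :=
    (hf.fderiv_right (m := 1) (by norm_num)).differentiableAt (by norm_num)
  have hs : IsSymmSndFDerivAt ℝ f x := hf.isSymmSndFDerivAt (by simp)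
  rw [fderiv_clm_apply hd hW, fderiv_clm_apply hd hV, lieBracket]
  simp only [map_sub, add_apply, ContinuousLinearMap.comp_apply,
    ContinuousLinearMap.flip_apply]
  rw [hs (V x) (W x)]
  abel

variable {E : Type*} [NormedAddCommGroup E] [NormedSpace ℝ E]
  {R : Type*} [TopologicalSpace R] [ChartedSpace E R]
  {A : Type*} [NormedRing A] [NormedAlgebra ℝ A]

variable (E) in
/-- The derivative of a vector-valued function on a manifold, with tangent spaces identified with
the model spaces. -/
noncomputable def differentialAt (f : R → A) (g : R) : E →L[ℝ] A := mfderiv 𝓘(ℝ, E) 𝓘(ℝ, A) f g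

theorem hasFDerivAt_comp_extChartAt_symm [IsManifold 𝓘(ℝ, E) 1 R] {f : R → A}
    (hf : MDifferentiable 𝓘(ℝ, E) 𝓘(ℝ, A) f) {x : R} {y : E}
    (hy : y ∈ (extChartAt 𝓘(ℝ, E) x).target) :
    HasFDerivAt (f ∘ (extChartAt 𝓘(ℝ, E) x).symm)
      (differentialAt E f ((extChartAt 𝓘(ℝ, E) x).symm y) ∘L
      (mfderivWithin 𝓘(ℝ, E) 𝓘(ℝ, E) (extChartAt 𝓘(ℝ, E) x).symm (range 𝓘(ℝ, E)) y : E →L[ℝ] E))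
      y := by
  have h1 : MDifferentiableWithinAt 𝓘(ℝ, E) 𝓘(ℝ, E) (extChartAt 𝓘(ℝ, E) x).symm
      (range 𝓘(ℝ, E)) y := mdifferentiableWithinAt_extChartAt_symm hy
  have h3 := (hf ((extChartAt 𝓘(ℝ, E) x).symm y)).hasMFDerivAt.comp_hasMFDerivWithinAt y
    h1.hasMFDerivWithinAt
  exact h3.hasFDerivWithinAt.hasFDerivAt (by simp)

variable [Group R] [LieGroup 𝓘(ℝ, E) ∞ R]

theorem differentialAt_mul_left (π : R →* A) (hπ : ContMDiff 𝓘(ℝ, E) 𝓘(ℝ, A) ∞ π)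
    (g h : R) (v : E) :
    differentialAt E π (g * h) (mfderiv 𝓘(ℝ, E) 𝓘(ℝ, E) (fun h : R => g * h) h v) =
      π g * differentialAt E π h v := by
  have hl : MDifferentiableAt 𝓘(ℝ, E) 𝓘(ℝ, E) (fun h : R => g * h) h :=
    (contMDiff_mul_left (n := ∞)).mdifferentiableAt (by simp)
  have hp : MDifferentiableAt 𝓘(ℝ, E) 𝓘(ℝ, A) π (g * h) := hπ.mdifferentiableAt (by simp)
  have hp1 : MDifferentiableAt 𝓘(ℝ, E) 𝓘(ℝ, A) π h := hπ.mdifferentiableAt (by simp)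
  have hm : HasFDerivAt (fun a : A => π g * a) (ContinuousLinearMap.mul ℝ A (π g))
      (π h) := (ContinuousLinearMap.mul ℝ A (π g)).hasFDerivAt
  have e : (fun a : A => π g * a) ∘ π = π ∘ (fun h => g * h) := by
    ext h; simp
  have h1 := hp.hasMFDerivAt.comp h hl.hasMFDerivAt
  have h2 := hm.hasMFDerivAt.comp h hp1.hasMFDerivAt
  rw [e] at h2
  exact congrArg (fun T : E →L[ℝ] A => T v) (hasMFDerivAt_unique h1 h2)

theorem differentialAt_mulInvariantVectorField (π : R →* A)
    (hπ : ContMDiff 𝓘(ℝ, E) 𝓘(ℝ, A) ∞ π) (v : GroupLieAlgebra 𝓘(ℝ, E) R) (g : R) :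
    differentialAt E π g (mulInvariantVectorField v g) = π g * differentialAt E π 1 v := by
  have h := differentialAt_mul_left π hπ g 1 v
  rwa [mul_one] at h

/-- The derivative of a homomorphism at any point is a translate of its derivative at `1`. -/
theorem exists_differentialAt_eq_mul (π : R →* A)
    (hπ : ContMDiff 𝓘(ℝ, E) 𝓘(ℝ, A) ∞ π) (g : R) (v : E) :
    ∃ w : E, differentialAt E π g v = π g * differentialAt E π 1 w := by
  have h := differentialAt_mul_left π hπ g⁻¹ g v
  rw [inv_mul_cancel] at h
  obtain ⟨w, hw⟩ : ∃ w : E, differentialAt E π 1 w = π g⁻¹ * differentialAt E π g v := ⟨_, h⟩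
  refine ⟨w, ?_⟩
  rw [hw, ← mul_assoc, ← map_mul, mul_inv_cancel, map_one, one_mul]

/-- The left-invariant field of u differentiates π to π · dπ(u). Applying two such fields in either
order and subtracting at 1 gives the commutator. -/
theorem differentialAt_bracket [CompleteSpace E] (π : R →* A)
    (hπ : ContMDiff 𝓘(ℝ, E) 𝓘(ℝ, A) ∞ π) (v w : GroupLieAlgebra 𝓘(ℝ, E) R) :
    differentialAt E π 1 (⁅v, w⁆ : GroupLieAlgebra 𝓘(ℝ, E) R) =
      differentialAt E π 1 v * differentialAt E π 1 w -
      differentialAt E π 1 w * differentialAt E π 1 v := by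
  set c := extChartAt 𝓘(ℝ, E) (1 : R) with hc
  set f : E → A := π ∘ c.symm with hf
  set P : GroupLieAlgebra 𝓘(ℝ, E) R → E → E := fun u =>
    mpullbackWithin 𝓘(ℝ, E) 𝓘(ℝ, E) c.symm (mulInvariantVectorField u) (range 𝓘(ℝ, E)) with hP
  have : IsManifold 𝓘(ℝ, E) 2 R := IsManifold.of_le (n := ∞) ENat.LEInfty.out
  have hPd : ∀ u, DifferentiableAt ℝ (P u) (c 1) := by
    intro u
    have := (mdifferentiableAt_mulInvariantVectorField (I := 𝓘(ℝ, E)) (G := R) u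
      (g := 1)).mdifferentiableWithinAt (s := univ)
    have := this.differentiableWithinAt_mpullbackWithin_vectorField
    rw [preimage_univ, univ_inter] at this
    refine this.differentiableAt ?_
    simp
  have hct : ∀ᶠ y in 𝓝 (c 1), y ∈ c.target := extChartAt_target_mem_nhds _
  have hfP : ∀ u, ∀ y ∈ c.target, fderiv ℝ f y (P u y) = f y * differentialAt E π 1 u := by
    intro u y hy
    rw [(hasFDerivAt_comp_extChartAt_symm (hπ.mdifferentiable (by simp)) hy).fderiv]
    have hinv := isInvertible_mfderivWithin_extChartAt_symm (I := 𝓘(ℝ, E)) hy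
    have h1 := (hinv.inverse_apply_eq (y := mulInvariantVectorField u (c.symm y))).1 rfl
    refine Eq.trans ?_ (differentialAt_mulInvariantVectorField π hπ u (c.symm y))
    exact congrArg (differentialAt E π (c.symm y)) h1.symm
  have hf1 : f (c 1) = 1 := by simp [hf, hc]
  have hc1 : c 1 ∈ c.target := mem_extChartAt_target _
  have hf2 : ContDiffAt ℝ 2 f (c 1) := by
    have h1 : ContMDiffAt 𝓘(ℝ, E) 𝓘(ℝ, E) ∞ c.symm (c 1) :=
      (contMDiffOn_extChartAt_symm (n := ∞) (1 : R)).contMDiffAt hct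
    exact ((hπ.contMDiffAt.comp (c 1) h1).contDiffAt).of_le ENat.LEInfty.out
  have hfP' : ∀ u z, fderiv ℝ (fun y => fderiv ℝ f y (P u y)) (c 1) z =
      fderiv ℝ f (c 1) z * differentialAt E π 1 u := by
    intro u z
    have : (fun y => fderiv ℝ f y (P u y)) =ᶠ[𝓝 (c 1)] fun y => f y * differentialAt E π 1 u := by
      filter_upwards [hct] with y hy using hfP u y hy
    rw [this.fderiv_eq, fderiv_mul_const' (hf2.differentiableAt (by simp))]
    simp
  have key := fderiv_apply_lieBracket hf2 (hPd v) (hPd w)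
  rw [hfP', hfP', hfP _ _ hc1, hfP _ _ hc1, hf1, one_mul, one_mul] at key
  rw [← key]
  -- b is the bracket in coordinates; what remains is to carry it back to the tangent space through
  -- the derivative of the chart.
  set b : E := lieBracket ℝ (P v) (P w) (c 1) with hb
  have hfc : (π : R → A) =ᶠ[𝓝 1] f ∘ c := by
    filter_upwards [extChartAt_source_mem_nhds (I := 𝓘(ℝ, E)) (1 : R)] with y hy
    simp only [hf, Function.comp_apply, c.left_inv hy]
  have hcd : MDifferentiableAt 𝓘(ℝ, E) 𝓘(ℝ, E) c 1 :=
      mdifferentiableAt_extChartAt (mem_chart_source _ _)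
  have h3 := (hf2.differentiableAt (by simp)).hasFDerivAt.hasMFDerivAt.comp 1 hcd.hasMFDerivAt
  obtain ⟨D, hD⟩ : ∃ D : E →L[ℝ] E, D = mfderiv 𝓘(ℝ, E) 𝓘(ℝ, E) c 1 := ⟨_, rfl⟩
  have h4 : differentialAt E π 1 = fderiv ℝ f (c 1) ∘L D := by
    rw [hD]
    exact (h3.congr_of_eventuallyEq hfc).mfderiv
  have hinv := isInvertible_mfderiv_extChartAt (I := 𝓘(ℝ, E)) (mem_extChartAt_source (1 : R))
  have h5 : (⁅v, w⁆ : GroupLieAlgebra 𝓘(ℝ, E) R) = (mfderiv 𝓘(ℝ, E) 𝓘(ℝ, E) c 1).inverse b := by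
    rw [GroupLieAlgebra.bracket_def, ← mlieBracketWithin_univ, mlieBracketWithin_apply,
      preimage_univ, univ_inter, hb, ← lieBracketWithin_univ]
    congr 2
    exact ModelWithCorners.range_eq_univ 𝓘(ℝ, E)
  obtain ⟨x, hx⟩ : ∃ x : E, x = (⁅v, w⁆ : GroupLieAlgebra 𝓘(ℝ, E) R) := ⟨_, rfl⟩
  have h6 : b = D x := by
    subst hD hx
    exact hinv.inverse_apply_eq.1 h5.symm
  rw [← hx, h4, ContinuousLinearMap.comp_apply, h6]

end differential

/-! ### Invariant subspaces of linear ODEs, and Lie's theorem over ℝ. -/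

section eigenpair

open scoped TensorProduct

/-- Invariance of S lets y be replaced by a representative of its class of nearly minimal norm. -/
theorem norm_mkQ_apply_le {W : Type*} [NormedAddCommGroup W] [NormedSpace ℝ W] (S : Submodule ℝ W)
    (A : W →L[ℝ] W) (hA : ∀ s ∈ S, A s ∈ S) (y : W) :
    ‖(Submodule.Quotient.mk (A y) : W ⧸ S)‖ ≤ ‖A‖ * ‖(Submodule.Quotient.mk y : W ⧸ S)‖ := by
  refine le_of_forall_pos_le_add fun ε hε => ?_
  obtain ⟨δ, hδ, hδε⟩ : ∃ δ > 0, ‖A‖ * δ ≤ ε :=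
    ⟨ε / (‖A‖ + 1), by positivity, by
      rw [mul_div_assoc', div_le_iff₀ (by positivity)]
      nlinarith [norm_nonneg A]⟩
  obtain ⟨z, hz, hzn⟩ := Submodule.Quotient.norm_mk_lt (Submodule.Quotient.mk y : W ⧸ S) hδ
  have h1 : (Submodule.Quotient.mk (A y) : W ⧸ S) = Submodule.Quotient.mk (A z) := by
    rw [eq_comm, Submodule.Quotient.eq, ← map_sub]
    exact hA _ ((Submodule.Quotient.eq S).1 hz)
  rw [h1]
  calc ‖(Submodule.Quotient.mk (A z) : W ⧸ S)‖ ≤ ‖A z‖ := Submodule.Quotient.norm_mk_le _ _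
    _ ≤ ‖A‖ * ‖z‖ := A.le_opNorm z
    _ ≤ ‖A‖ * (‖(Submodule.Quotient.mk y : W ⧸ S)‖ + δ) := by gcongr
    _ ≤ _ := by rw [mul_add]; gcongr

/-- A subspace invariant under the coefficients of a linear differential equation is preserved
by the flow. -/
theorem mem_submodule_of_hasDerivAt {W : Type*} [NormedAddCommGroup W] [NormedSpace ℝ W]
    (S : Submodule ℝ W) (hS : IsClosed (S : Set W)) {A : ℝ → W →L[ℝ] W} {y : ℝ → W}
    (hAc : ContinuousOn A (Icc 0 1)) (hA : ∀ t ∈ Icc (0 : ℝ) 1, ∀ s ∈ S, A t s ∈ S)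
    (hy : ∀ t ∈ Icc (0 : ℝ) 1, HasDerivAt y (A t (y t)) t) (h0 : y 0 ∈ S) : y 1 ∈ S := by
  obtain ⟨K, hK⟩ := isCompact_Icc.exists_bound_of_continuousOn hAc
  let q : W →L[ℝ] W ⧸ S := S.mkQL
  -- Grönwall for the class of y modulo S: it starts at 0 and its derivative is at most K times its
  -- norm.
  have h := norm_le_gronwallBound_of_norm_deriv_right_le (f := fun t => q (y t))
    (f' := fun t => q (A t (y t))) (δ := 0) (K := K) (ε := 0) (a := 0) (b := 1)
    (fun t ht => (q.continuous.continuousAt.comp (hy t ht).continuousAt).continuousWithinAt)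
    (fun t ht => (q.hasFDerivAt.comp_hasDerivAt t (hy t (Ico_subset_Icc_self ht))).hasDerivWithinAt)
    (by simpa [q] using h0)
    (fun t ht => by
      rw [add_zero]
      refine (norm_mkQ_apply_le S (A t) (hA t (Ico_subset_Icc_self ht)) (y t)).trans ?_
      exact mul_le_mul_of_nonneg_right (hK t (Ico_subset_Icc_self ht)) (norm_nonneg _))
    1 (by simp)
  rw [gronwallBound_ε0_δ0, norm_le_zero_iff] at h
  simpa [q] using h

/-- Lie's theorem over the reals: the real and imaginary parts of a complex eigenvector. -/
theorem exists_eigenpair_of_isSolvable {L V : Type*} [LieRing L] [LieAlgebra ℝ L]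
    [LieAlgebra.IsSolvable L] [AddCommGroup V] [Module ℝ V] [FiniteDimensional ℝ V] [Nontrivial V]
    [LieRingModule L V] [LieModule ℝ L V] :
    ∃ a b : V, (a ≠ 0 ∨ b ≠ 0) ∧
      ∀ x : L, ∃ α β : ℝ, ⁅x, a⁆ = α • a - β • b ∧ ⁅x, b⁆ = β • a + α • b := by
  obtain ⟨χ, hχ⟩ := LieModule.exists_nontrivial_weightSpace_of_isSolvable ℂ (ℂ ⊗[ℝ] L) (ℂ ⊗[ℝ] V)
  obtain ⟨⟨v, hv⟩, hv0⟩ := exists_ne (0 : LieModule.weightSpace (ℂ ⊗[ℝ] V) χ)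
  rw [LieModule.mem_weightSpace] at hv
  have hv0' : v ≠ 0 := fun h => hv0 (Subtype.ext h)
  -- The real and imaginary parts on ℂ ⊗ V commute with every 1 ⊗ x, so they split the complex
  -- eigenvector equation into the two real ones.
  let re : ℂ ⊗[ℝ] V →ₗ[ℝ] V := TensorProduct.lid ℝ V ∘ₗ TensorProduct.map Complex.reLm LinearMap.id
  let im : ℂ ⊗[ℝ] V →ₗ[ℝ] V := TensorProduct.lid ℝ V ∘ₗ TensorProduct.map Complex.imLm LinearMap.id
  have hre : ∀ z w, re (z ⊗ₜ w) = z.re • w := fun z w => by simp [re]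
  have him : ∀ z w, im (z ⊗ₜ w) = z.im • w := fun z w => by simp [im]
  have hdec : ∀ u : ℂ ⊗[ℝ] V, u = 1 ⊗ₜ re u + Complex.I ⊗ₜ im u := by
    intro u
    induction u with
    | zero => simp
    | tmul z w =>
      rw [hre, him, ← TensorProduct.smul_tmul, ← TensorProduct.smul_tmul, ← TensorProduct.add_tmul]
      congr 1
      apply Complex.ext <;> simp
    | add u w hu hw =>
      conv_lhs => rw [hu, hw]
      simp only [map_add, TensorProduct.tmul_add]
      abel
  have hresmul : ∀ (z : ℂ) u, re (z • u) = z.re • re u - z.im • im u := by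
    intro z u
    induction u with
    | zero => simp
    | tmul y w =>
      rw [TensorProduct.smul_tmul', hre, hre, him, smul_smul, smul_smul, ← sub_smul]
      simp
    | add u w hu hw => simp only [smul_add, map_add, hu, hw]; abel
  have himsmul : ∀ (z : ℂ) u, im (z • u) = z.im • re u + z.re • im u := by
    intro z u
    induction u with
    | zero => simp
    | tmul y w =>
      rw [TensorProduct.smul_tmul', him, hre, him, smul_smul, smul_smul, ← add_smul]
      simp [add_comm]
    | add u w hu hw => simp only [smul_add, map_add, hu, hw]; abel
  have hladd : ∀ (x : L) (u w : ℂ ⊗[ℝ] V), ⁅(1 : ℂ) ⊗ₜ[ℝ] x, u + w⁆ =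
      ⁅(1 : ℂ) ⊗ₜ[ℝ] x, u⁆ + ⁅(1 : ℂ) ⊗ₜ[ℝ] x, w⁆ := fun x u w =>
      (LieModule.toEnd ℂ (ℂ ⊗[ℝ] L) (ℂ ⊗[ℝ] V) ((1 : ℂ) ⊗ₜ[ℝ] x)).map_add u w
  have hl0 : ∀ x : L, ⁅(1 : ℂ) ⊗ₜ[ℝ] x, (0 : ℂ ⊗[ℝ] V)⁆ = 0 := fun x => by
    have h := hladd x 0 0
    rw [add_zero] at h
    exact left_eq_add.1 h
  have hrelie : ∀ (x : L) u, re ⁅(1 : ℂ) ⊗ₜ[ℝ] x, u⁆ = ⁅x, re u⁆ := by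
    intro x u
    induction u with
    | zero => rw [hl0]; simp
    | tmul y w =>
      rw [LieAlgebra.ExtendScalars.bracket_tmul, hre, hre, one_mul, lie_smul]
    | add u w hu hw => rw [hladd, map_add, map_add, lie_add, hu, hw]
  have himlie : ∀ (x : L) u, im ⁅(1 : ℂ) ⊗ₜ[ℝ] x, u⁆ = ⁅x, im u⁆ := by
    intro x u
    induction u with
    | zero => rw [hl0]; simp
    | tmul y w =>
      rw [LieAlgebra.ExtendScalars.bracket_tmul, him, him, one_mul, lie_smul]
    | add u w hu hw => rw [hladd, map_add, map_add, lie_add, hu, hw]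
  refine ⟨re v, im v, ?_, fun x => ⟨(χ (1 ⊗ₜ x)).re, (χ (1 ⊗ₜ x)).im, ?_, ?_⟩⟩
  · by_contra! h
    apply hv0'
    rw [hdec v, h.1, h.2]
    simp
  · rw [← hrelie, hv, hresmul]
  · rw [← himlie, hv, himsmul]

end eigenpair

/-! ### From invariance under the Lie algebra to invariance along curves. -/

section groupEigenpair

variable {V : Type*} [NormedAddCommGroup V] [NormedSpace ℝ V]

/-- The complex line through `a + i b`, as a real subspace of `V × V`. -/
def complexLine (a b : V) : Submodule ℝ (V × V) where
  carrier := {z | ∃ p q : ℝ, z = (p • a - q • b, q • a + p • b)}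
  zero_mem' := ⟨0, 0, by ext <;> simp⟩
  add_mem' := by
    rintro _ _ ⟨p, q, rfl⟩ ⟨p', q', rfl⟩
    exact ⟨p + p', q + q', by ext <;> simp [add_smul] <;> abel⟩
  smul_mem' := by
    rintro c _ ⟨p, q, rfl⟩
    exact ⟨c * p, c * q, by ext <;> simp [mul_smul, smul_sub, smul_add]⟩

/-- X acting on both components is complex linear on V × V, so testing the generator a + ib
suffices. -/
theorem prodMap_mem_complexLine {a b : V} {X : V →L[ℝ] V} (hX : (X a, X b) ∈ complexLine a b)
    {z : V × V} (hz : z ∈ complexLine a b) : (X z.1, X z.2) ∈ complexLine a b := by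
  obtain ⟨p, q, rfl⟩ := hz
  obtain ⟨α, β, h⟩ := hX
  obtain ⟨h1, h2⟩ := Prod.ext_iff.1 h
  simp only at h1 h2
  refine ⟨p * α - q * β, p * β + q * α, ?_⟩
  simp only [map_sub, map_add, map_smul, h1, h2]
  ext <;> simp only <;> module

/-- X multiplies a + ib by p + iq, nonzero because X has a left inverse; Y then multiplies by (p −
iq)/(p² + q²). -/
theorem inv_mem_complexLine {a b : V} (hab : a ≠ 0 ∨ b ≠ 0) {X Y : V →L[ℝ] V} (hYX : Y * X = 1)
    (hX : (X a, X b) ∈ complexLine a b) : (Y a, Y b) ∈ complexLine a b := by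
  have hY : ∀ v, Y (X v) = v := fun v => by
    have := congrArg (fun T : V →L[ℝ] V => T v) hYX
    simpa using this
  obtain ⟨p, q, h⟩ := hX
  obtain ⟨h1, h2⟩ := Prod.ext_iff.1 h
  simp only at h1 h2
  have hn : p ^ 2 + q ^ 2 ≠ 0 := by
    intro h0
    have hp : p = 0 := by nlinarith [sq_nonneg p, sq_nonneg q]
    have hq : q = 0 := by nlinarith [sq_nonneg p, sq_nonneg q]
    subst hp hq
    have ha := hY a
    have hb := hY b
    rw [h1] at ha
    rw [h2] at hb
    simp only [zero_smul, sub_zero, add_zero, map_zero] at ha hb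
    exact hab.elim (fun h => h ha.symm) (fun h => h hb.symm)
  have e1 : p • Y a - q • Y b = a := by rw [← map_smul, ← map_smul, ← map_sub, ← h1, hY]
  have e2 : q • Y a + p • Y b = b := by rw [← map_smul, ← map_smul, ← map_add, ← h2, hY]
  refine ⟨p / (p ^ 2 + q ^ 2), -q / (p ^ 2 + q ^ 2), ?_⟩
  have hA : Y a = (p ^ 2 + q ^ 2)⁻¹ • (p • a + q • b) := by
    rw [eq_inv_smul_iff₀ hn]
    calc (p ^ 2 + q ^ 2) • Y a = p • (p • Y a - q • Y b) + q • (q • Y a + p • Y b) := by module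
      _ = _ := by rw [e1, e2]
  have hB : Y b = (p ^ 2 + q ^ 2)⁻¹ • (-q • a + p • b) := by
    rw [eq_inv_smul_iff₀ hn]
    calc (p ^ 2 + q ^ 2) • Y b = -q • (p • Y a - q • Y b) + p • (q • Y a + p • Y b) := by module
      _ = _ := by rw [e1, e2]
  rw [hA, hB]
  ext <;> simp only <;> module

theorem eq_neg_of_mul_eq_one {A : Type*} [NormedRing A] [NormedAlgebra ℝ A] {F G : ℝ → A}
    {F' G' : A} {t : ℝ} (hF : HasDerivAt F F' t) (hG : HasDerivAt G G' t)
    (hGF : ∀ᶠ s in 𝓝 t, G s * F s = 1) (hFG : F t * G t = 1) : G' = -(G t * F' * G t) := by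
  have h1 := hG.mul hF
  have h2 : HasDerivAt (fun s => G s * F s) 0 t :=
    (hasDerivAt_const t (1 : A)).congr_of_eventuallyEq hGF
  have h3 := h1.unique h2
  have h4 : G' * (F t * G t) = -(G t * F' * G t) := by
    rw [← mul_assoc, eq_neg_iff_add_eq_zero, ← add_mul, h3, zero_mul]
  rwa [hFG, mul_one] at h4

/-- The inverse G is followed because G' = −(G F') G has the line-preserving coefficient on the
left, whereas F' = F (G F') has it on the right. -/
theorem mem_complexLine_of_hasDerivAt [FiniteDimensional ℝ V] {a b : V}
    {F F' G G' : ℝ → V →L[ℝ] V} (hF : ∀ t ∈ Icc (0 : ℝ) 1, HasDerivAt F (F' t) t)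
    (hG : ∀ t ∈ Icc (0 : ℝ) 1, HasDerivAt G (G' t) t) (hF' : ContinuousOn F' (Icc 0 1))
    (hGF : ∀ t, G t * F t = 1) (hFG : ∀ t, F t * G t = 1) (h0 : G 0 = 1)
    (hX : ∀ t ∈ Icc (0 : ℝ) 1, ((G t * F' t) a, (G t * F' t) b) ∈ complexLine a b) :
    (G 1 a, G 1 b) ∈ complexLine a b := by
  let X : ℝ → V →L[ℝ] V := fun t => -(G t * F' t)
  have hXc : ContinuousOn X (Icc 0 1) := by
    have : ContinuousOn G (Icc 0 1) := fun t ht => (hG t ht).continuousAt.continuousWithinAt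
    exact (this.mul hF').neg
  have := mem_submodule_of_hasDerivAt (complexLine a b)
    (Submodule.closed_of_finiteDimensional _) (A := fun t => (X t).prodMap (X t))
    (y := fun t => (G t a, G t b)) ?_ ?_ ?_ ?_
  · exact this
  · have hc : Continuous fun T : V →L[ℝ] V => T.prodMap T :=
      (ContinuousLinearMap.prodMapL ℝ V V V V).continuous.comp (continuous_id.prodMk continuous_id)
    exact hc.comp_continuousOn hXc
  · intro t ht s hs
    exact prodMap_mem_complexLine (X := X t) (neg_mem (hX t ht)) hs
  · intro t ht
    have hd : G' t = X t * G t := by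
      rw [eq_neg_of_mul_eq_one (hF t ht) (hG t ht) (Eventually.of_forall hGF) (hFG t), neg_mul]
    have h1 : ∀ v : V, HasDerivAt (fun t => G t v) (X t (G t v)) t := fun v => by
      have := (hG t ht).clm_apply (hasDerivAt_const t v)
      simpa [hd] using this
    exact (h1 a).prodMk (h1 b)
  · rw [h0]
    exact ⟨1, 0, by simp⟩

theorem exists_forall_differentialAt_mem_complexLine {E : Type*} [NormedAddCommGroup E] [NormedSpace ℝ E]
    [FiniteDimensional ℝ E] {R : Type*} [TopologicalSpace R] [ChartedSpace E R] [Group R]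
    [LieGroup 𝓘(ℝ, E) ∞ R] (hR : LieAlgebra.IsSolvable (GroupLieAlgebra 𝓘(ℝ, E) R))
    [FiniteDimensional ℝ V] [Nontrivial V] (π : R →* (V →L[ℝ] V))
    (hπ : ContMDiff 𝓘(ℝ, E) 𝓘(ℝ, V →L[ℝ] V) ∞ π) :
    ∃ a b : V, (a ≠ 0 ∨ b ≠ 0) ∧
      ∀ w : E, (differentialAt E π 1 w a, differentialAt E π 1 w b) ∈ complexLine a b := by
  let _ : LieRingModule (GroupLieAlgebra 𝓘(ℝ, E) R) V :=
    { bracket := fun x v => differentialAt E π 1 x v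
      add_lie := fun x y v => by
        have : differentialAt E π 1 (x + y) = differentialAt E π 1 x + differentialAt E π 1 y :=
          map_add _ _ _
        change differentialAt E π 1 (x + y) v = _
        rw [this]; rfl
      lie_add := fun x v w => map_add (differentialAt E π 1 x) v w
      leibniz_lie := fun x y v => by
        have := differentialAt_bracket π hπ x y
        have h2 := congrArg (fun T : V →L[ℝ] V => T v) this
        exact sub_eq_iff_eq_add.1 h2.symm }
  have : LieModule ℝ (GroupLieAlgebra 𝓘(ℝ, E) R) V :=
    { smul_lie := fun t x v => by
        have : differentialAt E π 1 (t • x) = t • differentialAt E π 1 x := map_smul _ _ _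
        change differentialAt E π 1 (t • x) v = _
        rw [this]; rfl
      lie_smul := fun t x v => map_smul (differentialAt E π 1 x) t v }
  obtain ⟨a, b, hab, h⟩ := exists_eigenpair_of_isSolvable (L := GroupLieAlgebra 𝓘(ℝ, E) R) (V := V)
  refine ⟨a, b, hab, fun w => ?_⟩
  obtain ⟨α, β, h1, h2⟩ := h w
  exact ⟨α, β, Prod.ext h1 h2⟩

end groupEigenpair

/-! ### Lie's theorem for the group, and conformal subspaces. -/

section conformalSubspace

variable {V : Type*} [NormedAddCommGroup V] [NormedSpace ℝ V]

/-- Near 1, join g to 1 by a straight segment in the chart. The logarithmic derivative of π along it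
stays in the image of dπ, which preserves the line. -/
theorem eventually_mem_complexLine {E : Type*} [NormedAddCommGroup E] [NormedSpace ℝ E]
    {R : Type*} [TopologicalSpace R] [ChartedSpace E R] [Group R]
    [LieGroup 𝓘(ℝ, E) ∞ R] [FiniteDimensional ℝ V] (π : R →* (V →L[ℝ] V))
    (hπ : ContMDiff 𝓘(ℝ, E) 𝓘(ℝ, V →L[ℝ] V) ∞ π) {a b : V}
    (h : ∀ w : E, (differentialAt E π 1 w a, differentialAt E π 1 w b) ∈ complexLine a b) :
    ∀ᶠ g : R in 𝓝 1, (π g⁻¹ a, π g⁻¹ b) ∈ complexLine a b := by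
  set c := extChartAt 𝓘(ℝ, E) (1 : R) with hc
  have hto : IsOpen c.target := isOpen_extChartAt_target 1
  obtain ⟨r, hr, hball⟩ := Metric.isOpen_iff.1 hto (c 1) (mem_extChartAt_target _)
  have hcs : ContMDiffOn 𝓘(ℝ, E) 𝓘(ℝ, E) ∞ c.symm c.target := contMDiffOn_extChartAt_symm 1
  have hf : ContDiffOn ℝ ∞ (fun x => π (c.symm x)) c.target :=
    (hπ.comp_contMDiffOn hcs).contDiffOn
  have hg : ContDiffOn ℝ ∞ (fun x => π (c.symm x)⁻¹) c.target :=
    (hπ.comp_contMDiffOn hcs.inv).contDiffOn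
  have key : ∀ x ∈ Metric.ball (c 1) r, (π (c.symm x)⁻¹ a, π (c.symm x)⁻¹ b) ∈ complexLine a b := by
    intro x hx
    let γ : ℝ → E := fun t => c 1 + t • (x - c 1)
    have hγt : ∀ t ∈ Icc (0 : ℝ) 1, γ t ∈ c.target := fun t ht => by
      refine hball ((convex_ball (c 1) r).add_smul_sub_mem (Metric.mem_ball_self hr) hx ht)
    have hγd : ∀ t, HasDerivAt γ (x - c 1) t := fun t => by
      have h := ((hasDerivAt_id t).smul_const (x - c 1)).const_add (c 1)
      rwa [one_smul] at h
    have hγc : Continuous γ := by fun_prop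
    have hfd : ∀ y ∈ c.target, DifferentiableAt ℝ (fun x => π (c.symm x)) y := fun y hy =>
      (hf.contDiffAt (hto.mem_nhds hy)).differentiableAt (by simp)
    have hgd : ∀ y ∈ c.target, DifferentiableAt ℝ (fun x => π (c.symm x)⁻¹) y := fun y hy =>
      (hg.contDiffAt (hto.mem_nhds hy)).differentiableAt (by simp)
    have hγ1 : γ 1 = x := by simp [γ]
    have hγ0 : γ 0 = c 1 := by simp [γ]
    rw [← hγ1]
    refine mem_complexLine_of_hasDerivAt (F := fun t => π (c.symm (γ t)))
      (G := fun t => π (c.symm (γ t))⁻¹)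
      (F' := fun t => fderiv ℝ (fun x => π (c.symm x)) (γ t) (x - c 1))
      (G' := fun t => fderiv ℝ (fun x => π (c.symm x)⁻¹) (γ t) (x - c 1))
      (fun t ht => (hfd _ (hγt t ht)).hasFDerivAt.comp_hasDerivAt t (hγd t))
      (fun t ht => (hgd _ (hγt t ht)).hasFDerivAt.comp_hasDerivAt t (hγd t))
      ?_ ?_ ?_ ?_ ?_
    · have h1 : ContinuousOn (fderiv ℝ (fun x => π (c.symm x))) c.target :=
        hf.continuousOn_fderiv_of_isOpen hto (by simp)
      exact (h1.comp hγc.continuousOn hγt).clm_apply continuousOn_const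
    · intro t
      rw [← map_mul, inv_mul_cancel, map_one]
    · intro t
      rw [← map_mul, mul_inv_cancel, map_one]
    · simp [hγ0, hc]
    · intro t ht
      have h4 := (hasFDerivAt_comp_extChartAt_symm (hπ.mdifferentiable (by simp))
        (hγt t ht)).fderiv
      obtain ⟨w, hw⟩ : ∃ w : E, fderiv ℝ (fun x => π (c.symm x)) (γ t) (x - c 1) =
          π (c.symm (γ t)) * differentialAt E π 1 w := by
        obtain ⟨w, hw⟩ := exists_differentialAt_eq_mul π hπ (c.symm (γ t))
          (mfderivWithin 𝓘(ℝ, E) 𝓘(ℝ, E) c.symm (range 𝓘(ℝ, E)) (γ t) (x - c 1))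
        refine ⟨w, Eq.trans ?_ hw⟩
        exact congrArg (fun T : E →L[ℝ] (V →L[ℝ] V) => T (x - c 1)) h4
      have h5 : π (c.symm (γ t))⁻¹ * fderiv ℝ (fun x => π (c.symm x)) (γ t) (x - c 1) =
          differentialAt E π 1 w := by
        rw [hw, ← mul_assoc, ← map_mul, inv_mul_cancel, map_one, one_mul]
      rw [h5]
      exact h w
  have hcont : ContinuousAt c 1 := continuousAt_extChartAt _
  filter_upwards [extChartAt_source_mem_nhds (I := 𝓘(ℝ, E)) (1 : R),
    hcont.eventually (Metric.ball_mem_nhds _ hr)] with g hgs hgb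
  have := key _ hgb
  rwa [c.left_inv hgs] at this

/-- The stabilizer of a complex line. -/
def complexLineStabilizer {G : Type*} [Group G] (π : G →* (V →L[ℝ] V)) {a b : V}
    (hab : a ≠ 0 ∨ b ≠ 0) : Subgroup G where
  carrier := {g | (π g a, π g b) ∈ complexLine a b}
  mul_mem' := by
    intro g h hg hh
    change (π (g * h) a, π (g * h) b) ∈ complexLine a b
    rw [map_mul]
    exact prodMap_mem_complexLine hg hh
  one_mem' := ⟨1, 0, by simp⟩
  inv_mem' := by
    intro g hg
    exact inv_mem_complexLine hab (by rw [← map_mul, inv_mul_cancel, map_one]) hg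

variable {E : Type*} [NormedAddCommGroup E] [NormedSpace ℝ E]
    [FiniteDimensional ℝ E] {R : Type*} [TopologicalSpace R] [ChartedSpace E R] [Group R]
    [LieGroup 𝓘(ℝ, E) ∞ R]

/-- Lie's theorem for continuous representations of a connected Lie group with solvable Lie
algebra, over the reals. -/
theorem exists_forall_mem_complexLine [ConnectedSpace R]
    (hR : LieAlgebra.IsSolvable (GroupLieAlgebra 𝓘(ℝ, E) R))
    [FiniteDimensional ℝ V] [Nontrivial V] (π : R →* (V →L[ℝ] V)) (hπ : Continuous π) :
    ∃ a b : V, (a ≠ 0 ∨ b ≠ 0) ∧ ∀ g, (π g a, π g b) ∈ complexLine a b := by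
  have := topologicalGroup_of_lieGroup 𝓘(ℝ, E) ∞ (G := R)
  have hsm : ContMDiff 𝓘(ℝ, E) 𝓘(ℝ, V →L[ℝ] V) ∞ π := contMDiff_of_continuous_monoidHom π hπ
  obtain ⟨a, b, hab, h⟩ := exists_forall_differentialAt_mem_complexLine hR π hsm
  refine ⟨a, b, hab, ?_⟩
  let S := complexLineStabilizer π hab
  have hS : (S : Set R) ∈ 𝓝 (1 : R) := by
    filter_upwards [eventually_mem_complexLine π hsm h] with g hg
    exact S.inv_mem_iff.1 hg
  have hopen : IsOpen (S : Set R) := S.isOpen_of_mem_nhds hS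
  have huniv := IsClopen.eq_univ ⟨S.isClosed_of_isOpen hopen, hopen⟩ ⟨1, S.one_mem⟩
  intro g
  have : g ∈ (S : Set R) := huniv ▸ mem_univ g
  exact this

/-- The eigenvalue is nonzero; its absolute value is the scale and its sign is an isometry of ℝ. -/
theorem exists_conformal_of_eigenvector {G : Type*} [Group G] (π : G →* (V →L[ℝ] V)) {u : V}
    (hu : u ≠ 0) (h : ∀ g, ∃ r : ℝ, π g u = r • u) :
    ∃ (j : ℝ →ₗ[ℝ] V) (χ : G → ℝ) (O : G → ℝ ≃ₗᵢ[ℝ] ℝ), Function.Injective j ∧ (∀ g, 0 < χ g) ∧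
      ∀ g x, π g (j x) = j (χ g • O g x) := by
  choose r hr using h
  have hr0 : ∀ g, r g ≠ 0 := fun g h0 => by
    have h1 : π g⁻¹ (π g u) = u := by
      rw [← mul_apply_eq_comp, ← map_mul, inv_mul_cancel, map_one]; rfl
    rw [hr, h0, zero_smul, map_zero] at h1
    exact hu h1.symm
  refine ⟨LinearMap.toSpanSingleton ℝ V u, fun g => |r g|,
    fun g => if 0 < r g then .refl ℝ ℝ else .neg ℝ, ?_, fun g => abs_pos.2 (hr0 g), ?_⟩
  · intro x y hxy
    simpa [LinearMap.toSpanSingleton_apply, hu] using hxy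
  · intro g x
    rw [LinearMap.toSpanSingleton_apply, LinearMap.toSpanSingleton_apply, map_smul, hr, smul_smul]
    congr 1
    dsimp only
    split_ifs with h0
    · simp [abs_of_pos h0, mul_comm]
    · simp [abs_of_nonpos (not_lt.1 h0), mul_comm]

theorem exists_conformal_of_complexLine {G : Type*} [Group G] (π : G →* (V →L[ℝ] V)) {a b : V}
    (hab : LinearIndependent ℝ ![a, b]) (h : ∀ g, (π g a, π g b) ∈ complexLine a b) :
    ∃ (j : ℂ →ₗ[ℝ] V) (χ : G → ℝ) (O : G → ℂ ≃ₗᵢ[ℝ] ℂ), Function.Injective j ∧ (∀ g, 0 < χ g) ∧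
      ∀ g x, π g (j x) = j (χ g • O g x) := by
  rw [LinearIndependent.pair_iff] at hab
  choose p q hpq using h
  have ha : ∀ g, π g a = p g • a - q g • b := fun g => congrArg Prod.fst (hpq g)
  have hb : ∀ g, π g b = q g • a + p g • b := fun g => congrArg Prod.snd (hpq g)
  -- In the coordinates 1 ↦ a, i ↦ b the action is multiplication by the conjugate p − iq, that is,
  -- ‖w‖ times a rotation.
  let w : G → ℂ := fun g => ⟨p g, -q g⟩
  have ha0 : a ≠ 0 := fun h0 => by simpa using hab 1 0 (by simp [h0])
  have hw : ∀ g, w g ≠ 0 := fun g h0 => by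
    have hp : p g = 0 := congrArg Complex.re h0
    have hq : q g = 0 := by simpa [w] using congrArg Complex.im h0
    have h1 : π g⁻¹ (π g a) = a := by
      rw [← mul_apply_eq_comp, ← map_mul, inv_mul_cancel, map_one]; rfl
    rw [ha, hp, hq, zero_smul, zero_smul, sub_zero, map_zero] at h1
    exact ha0 h1.symm
  let j : ℂ →ₗ[ℝ] V :=
    Complex.reLm.smulRight a + Complex.imLm.smulRight b
  have hj : ∀ z, j z = z.re • a + z.im • b := fun z => by simp [j]
  refine ⟨j, fun g => ‖w g‖, fun g => rotation (Circle.exp (w g).arg), ?_,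
    fun g => norm_pos_iff.2 (hw g), ?_⟩
  · rw [← LinearMap.ker_eq_bot, LinearMap.ker_eq_bot']
    intro z hz
    obtain ⟨h1, h2⟩ := hab _ _ ((hj z).symm.trans hz)
    exact Complex.ext h1 h2
  · intro g x
    have e : ‖w g‖ • rotation (Circle.exp (w g).arg) x = w g * x := by
      rw [rotation_apply, Complex.real_smul, ← mul_assoc, Circle.coe_exp,
        Complex.norm_mul_exp_arg_mul_I]
    rw [e, hj, hj, map_add, map_smul, map_smul, ha, hb]
    simp only [Complex.mul_re, Complex.mul_im, w]
    module

/-- Every nonzero representation of a connected Lie group with solvable Lie algebra has a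
nonzero subspace on which the group acts conformally. -/
theorem exists_conformal_subspace [ConnectedSpace R]
    (hR : LieAlgebra.IsSolvable (GroupLieAlgebra 𝓘(ℝ, E) R))
    [FiniteDimensional ℝ V] [Nontrivial V] (π : R →* (V →L[ℝ] V)) (hπ : Continuous π) :
    ∃ (W : Type) (_ : NormedAddCommGroup W) (_ : NormedSpace ℝ W) (_ : FiniteDimensional ℝ W)
      (_ : Nontrivial W) (j : W →ₗ[ℝ] V) (χ : R → ℝ) (O : R → W ≃ₗᵢ[ℝ] W),
      Function.Injective j ∧ (∀ g, 0 < χ g) ∧ ∀ g x, π g (j x) = j (χ g • O g x) := by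
  obtain ⟨a, b, hab, h⟩ := exists_forall_mem_complexLine hR π hπ
  by_cases hli : LinearIndependent ℝ ![a, b]
  · obtain ⟨j, χ, O, h⟩ := exists_conformal_of_complexLine π hli h
    exact ⟨ℂ, inferInstance, inferInstance, inferInstance, inferInstance, j, χ, O, h⟩
  -- If a and b are dependent, both are multiples of one vector u, which is then a common real
  -- eigenvector.
  · obtain ⟨u, hu, s, t, rfl, rfl⟩ : ∃ u : V, u ≠ 0 ∧ ∃ s t : ℝ, a = s • u ∧ b = t • u := by
      rw [LinearIndependent.pair_iff] at hli
      push Not at hli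
      obtain ⟨s, t, hst, hne⟩ := hli
      by_cases hs : s = 0
      · have ht := hne hs
        have hb : b = 0 := by simpa [hs, ht] using hst
        exact ⟨a, by simpa [hb] using hab, 1, 0, by simp, by simp [hb]⟩
      · have ha : a = (-t / s) • b := by
          rw [neg_div, neg_smul, div_eq_inv_mul, mul_smul, ← smul_neg, eq_inv_smul_iff₀ hs]
          exact eq_neg_of_add_eq_zero_left hst
        refine ⟨b, fun hb => ?_, -t / s, 1, ha, by simp⟩
        rw [hb, smul_zero] at ha
        exact hab.elim (fun h => h ha) (fun h => h hb)
    have hu' : ∀ g, ∃ r : ℝ, π g u = r • u := by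
      intro g
      obtain ⟨p, q, hpq⟩ := h g
      obtain ⟨h1, h2⟩ := Prod.ext_iff.1 hpq
      simp only [map_smul] at h1 h2
      by_cases hs : s = 0
      · have ht : t ≠ 0 := by
          rintro rfl
          simp [hs] at hab
        refine ⟨t⁻¹ * (q * s + p * t), ?_⟩
        rw [mul_smul, eq_inv_smul_iff₀ ht, h2]
        module
      · refine ⟨s⁻¹ * (p * s - q * t), ?_⟩
        rw [mul_smul, eq_inv_smul_iff₀ hs, h1]
        module
    obtain ⟨j, χ, O, h⟩ := exists_conformal_of_eigenvector π hu hu'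
    exact ⟨ℝ, inferInstance, inferInstance, inferInstance, inferInstance, j, χ, O, h⟩

end conformalSubspace

/-! ### Conformal approximations and their extension by a conformal subspace. -/

section approx

/-- A model of the operators `ρ g`, `g ∈ F`: up to conjugation they are arbitrarily close to
`D (a g) ∘ O g`, where `D` is a continuous representation of `ℝᵖ` and the `O g` are isometries
commuting with `D`. -/
structure ConformalApprox {G V : Type*} [NormedAddCommGroup V] [NormedSpace ℝ V]
    (ρ : G → V →L[ℝ] V) (F : Set G) (M : Type*) [NormedAddCommGroup M] [NormedSpace ℝ M] where
  rank : ℕ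
  D : (Fin rank → ℝ) → M →L[ℝ] M
  O : G → M →L[ℝ] M
  a : G → Fin rank → ℝ
  bound : ℝ
  continuous_D : Continuous D
  D_zero : D 0 = 1
  D_add : ∀ s t, D (s + t) = D s * D t
  norm_O : ∀ g x, ‖O g x‖ = ‖x‖
  O_D : ∀ g t x, O g (D t x) = D t (O g x)
  abs_a_le : ∀ g ∈ F, ∀ i, |a g i| ≤ bound
  exists_equiv : ∀ ε > 0, ∃ T : V ≃ₗ[ℝ] M, ∀ g ∈ F, ∀ v,
    ‖T (ρ g v) - D (a g) (O g (T v))‖ ≤ ε * ‖T v‖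

theorem nonempty_conformalApprox_of_subsingleton {G V : Type*} [NormedAddCommGroup V]
    [NormedSpace ℝ V] [Subsingleton V] (ρ : G → V →L[ℝ] V) (F : Set G) :
    Nonempty (ConformalApprox ρ F (Fin 0 → ℝ)) :=
  ⟨{  rank := 0
      D := fun _ => 1
      O := fun _ => 1
      a := fun _ => 0
      bound := 0
      continuous_D := continuous_const
      D_zero := rfl
      D_add := fun _ _ => (one_mul _).symm
      norm_O := fun _ _ => rfl
      O_D := fun _ _ _ => rfl
      abs_a_le := fun _ _ i => i.elim0
      exists_equiv := fun ε hε => ⟨0, fun g _ v => by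
        rw [Subsingleton.elim (_ - _ : Fin 0 → ℝ) 0, norm_zero]; positivity⟩ }⟩

variable {G : Type*} [TopologicalSpace G] {V W Q : Type*} [NormedAddCommGroup V]
  [NormedSpace ℝ V] [NormedAddCommGroup W] [NormedSpace ℝ W] [NormedAddCommGroup Q]
  [NormedSpace ℝ Q] [FiniteDimensional ℝ V]

/-- χ is recovered as a ratio of norms involving only ρ, so it is continuous although no continuity
of O is known. -/
theorem exists_abs_log_le [Nontrivial W] {ρ : G → V →L[ℝ] V} (hρ : Continuous ρ) {F : Set G}
    (hF : IsCompact (closure F)) {χ : G → ℝ} (hχ : ∀ g, 0 < χ g) {j : W →ₗ[ℝ] V}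
    {P : V →ₗ[ℝ] W} (hP : ∀ w, P (j w) = w) {O : G → W ≃ₗᵢ[ℝ] W}
    (h : ∀ g x, ρ g (j x) = j (χ g • O g x)) : ∃ L, ∀ g ∈ F, |Real.log (χ g)| ≤ L := by
  obtain ⟨w, hw⟩ := exists_ne (0 : W)
  have e : χ = fun g => ‖P (ρ g (j w))‖ / ‖w‖ := by
    ext g
    rw [h, hP, norm_smul, LinearIsometryEquiv.norm_map, Real.norm_of_nonneg (hχ g).le,
      mul_div_cancel_right₀ _ (norm_ne_zero_iff.2 hw)]
  have hc : Continuous χ := by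
    rw [e]
    have := P.continuous_of_finiteDimensional
    fun_prop
  obtain ⟨L, hL⟩ := hF.exists_bound_of_continuousOn
    (hc.log fun g => (hχ g).ne').continuousOn
  exact ⟨L, fun g hg => hL g (subset_closure hg)⟩

/-- Gluing a conformal subspace to a conformal approximation of the quotient. -/
theorem ConformalApprox.nonempty_extension [FiniteDimensional ℝ W] [FiniteDimensional ℝ Q]
    [Nontrivial W] {M : Type*} [NormedAddCommGroup M]
    [NormedSpace ℝ M] {ρ : G → V →L[ℝ] V} (hρ : Continuous ρ) {F : Set G}
    (hF : IsCompact (closure F)) {χ : G → ℝ} (hχ : ∀ g, 0 < χ g) {j : W →ₗ[ℝ] V}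
    {O : G → W ≃ₗᵢ[ℝ] W} (h : ∀ g x, ρ g (j x) = j (χ g • O g x))
    {P : V →ₗ[ℝ] W} {s : Q →ₗ[ℝ] V} {m : V →ₗ[ℝ] Q} (hP : ∀ w, P (j w) = w)
    (hm : ∀ q, m (s q) = q) (hmj : ∀ w, m (j w) = 0) (hPs : ∀ q, P (s q) = 0)
    (hv : ∀ v, v = j (P v) + s (m v)) {σ : G → Q →L[ℝ] Q} (hσ : ∀ g v, m (ρ g v) = σ g (m v))
    (A : ConformalApprox σ F M) : Nonempty (ConformalApprox ρ F (W × M)) := by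
  obtain ⟨L, hL⟩ := exists_abs_log_le hρ hF hχ hP h
  obtain ⟨C, hC⟩ : ∃ C, ∀ g ∈ F, ∀ q, ‖P (ρ g (s q))‖ ≤ C * ‖q‖ := by
    let B : G → Q →L[ℝ] W := fun g =>
      (LinearMap.toContinuousLinearMap P ∘L ρ g) ∘L LinearMap.toContinuousLinearMap s
    have hB : Continuous B := (continuous_const.clm_comp hρ).clm_comp continuous_const
    obtain ⟨C, hC⟩ := hF.exists_bound_of_continuousOn hB.continuousOn
    exact ⟨C, fun g hg q => (B g).le_of_opNorm_le (hC g (subset_closure hg)) q⟩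
  refine ⟨{
    rank := A.rank + 1
    D := fun t => (Real.exp (t 0) • (1 : W →L[ℝ] W)).prodMap (A.D (Fin.tail t))
    O := fun g => ((O g).toContinuousLinearEquiv : W →L[ℝ] W).prodMap (A.O g)
    a := fun g => Fin.cons (Real.log (χ g)) (A.a g)
    bound := max L A.bound
    continuous_D := ?_
    D_zero := ?_
    D_add := ?_
    norm_O := ?_
    O_D := ?_
    abs_a_le := ?_
    exists_equiv := ?_ }⟩
  · have h1 : Continuous fun t : Fin (A.rank + 1) → ℝ => Real.exp (t 0) • (1 : W →L[ℝ] W) := by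
      fun_prop
    have h2 : Continuous fun t : Fin (A.rank + 1) → ℝ => A.D (Fin.tail t) :=
      A.continuous_D.comp (continuous_pi fun i => continuous_apply _)
    exact (ContinuousLinearMap.prodMapL ℝ W W M M).continuous.comp (h1.prodMk h2)
  · have : Fin.tail (0 : Fin (A.rank + 1) → ℝ) = 0 := rfl
    rw [this, A.D_zero]
    ext x <;> simp
  · intro s t
    have : Fin.tail (s + t) = Fin.tail s + Fin.tail t := rfl
    rw [this, A.D_add]
    ext x <;> simp [Real.exp_add, mul_smul]
  · rintro g ⟨x, y⟩
    simp [Prod.norm_def, A.norm_O]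
  · rintro g t ⟨x, y⟩
    simp [A.O_D]
  · intro g hg i
    refine Fin.cases ?_ (fun i => ?_) i
    · simpa using Or.inl (hL g hg)
    · simpa using Or.inr (A.abs_a_le g hg i)
  · intro ε hε
    obtain ⟨T, hT⟩ := A.exists_equiv ε hε
    obtain ⟨K, hK0, hK⟩ : ∃ K, 0 ≤ K ∧ ∀ q, ‖q‖ ≤ K * ‖T q‖ := by
      have : FiniteDimensional ℝ M := T.finiteDimensional
      let S := LinearMap.toContinuousLinearMap (T.symm : M →ₗ[ℝ] Q)
      refine ⟨‖S‖, norm_nonneg _, fun q => ?_⟩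
      have := S.le_opNorm (T q)
      simpa [S] using this
    -- Scaling the W-coordinate by c commutes with the diagonal block but multiplies the
    -- off-diagonal term by c, which brings it below ε.
    set c : ℝ := ε / (|C| * K + 1) with hc
    have hc0 : 0 < c := by positivity
    have hcC : c * (|C| * K) ≤ ε := by
      rw [hc, div_mul_eq_mul_div, div_le_iff₀ (by positivity)]
      nlinarith
    let T₀ : V →ₗ[ℝ] W × M := (c • P).prod ((T : Q →ₗ[ℝ] M) ∘ₗ m)
    have hT₀ : Function.Bijective T₀ := by
      constructor
      · rw [← LinearMap.ker_eq_bot, LinearMap.ker_eq_bot']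
        intro v hv0
        obtain ⟨h1, h2⟩ := Prod.ext_iff.1 hv0
        have h1' : P v = 0 := by simpa [T₀, hc0.ne'] using h1
        have h2' : m v = 0 := by simpa [T₀] using h2
        rw [hv v, h1', h2', map_zero, map_zero, add_zero]
      · rintro ⟨w, y⟩
        refine ⟨j (c⁻¹ • w) + s (T.symm y), ?_⟩
        ext
        · simp [T₀, hP, hPs, hc0.ne', smul_smul]
        · simp [T₀, hm, hmj]
    refine ⟨LinearEquiv.ofBijective T₀ hT₀, fun g hg v => ?_⟩
    have e1 : P (ρ g v) = χ g • O g (P v) + P (ρ g (s (m v))) := by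
      conv_lhs => rw [hv v]
      rw [map_add, map_add, h, hP]
    have e2 : LinearEquiv.ofBijective T₀ hT₀ v = (c • P v, T (m v)) := rfl
    have e3 : LinearEquiv.ofBijective T₀ hT₀ (ρ g v) = (c • P (ρ g v), T (σ g (m v))) := by
      rw [← hσ]; rfl
    rw [e2, e3]
    have e4 : (Fin.tail (Fin.cons (Real.log (χ g)) (A.a g) : Fin (A.rank + 1) → ℝ)) = A.a g :=
      Fin.tail_cons _ _
    rw [e4]
    have hle : ‖T (m v)‖ ≤ ‖(c • P v, T (m v))‖ := norm_snd_le (c • P v, T (m v))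
    rw [Prod.norm_def]
    refine max_le ?_ ?_
    · have e5 : c • P (ρ g v) - χ g • O g (c • P v) = c • P (ρ g (s (m v))) := by
        rw [e1, map_smul]
        module
      change ‖c • P (ρ g v) - (Real.exp (Real.log (χ g)) • (1 : W →L[ℝ] W)) (O g (c • P v))‖ ≤ _
      rw [Real.exp_log (hχ g)]
      refine (congrArg norm e5).le.trans ?_
      rw [norm_smul, Real.norm_of_nonneg hc0.le]
      calc c * ‖P (ρ g (s (m v)))‖ ≤ c * (|C| * (K * ‖T (m v)‖)) := by
            gcongr
            refine (hC g hg _).trans ?_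
            gcongr
            · exact le_abs_self C
            · exact hK _
        _ = c * (|C| * K) * ‖T (m v)‖ := by ring
        _ ≤ ε * ‖(c • P v, T (m v))‖ := by gcongr
    · refine (hT g hg (m v)).trans ?_
      gcongr

end approx

/-- The representation induced on the quotient by an invariant subspace. -/
theorem exists_quotient_monoidHom {G V : Type*} [Group G] [NormedAddCommGroup V]
    [NormedSpace ℝ V] [FiniteDimensional ℝ V] (π : G →* (V →L[ℝ] V)) (S : Submodule ℝ V)
    (hS : ∀ g, ∀ v ∈ S, π g v ∈ S) :
    ∃ σ : G →* ((V ⧸ S) →L[ℝ] (V ⧸ S)), ∀ g v, σ g (S.mkQ v) = S.mkQ (π g v) := by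
  have := S.closed_of_finiteDimensional
  let σ : G → ((V ⧸ S) →L[ℝ] (V ⧸ S)) := fun g =>
    LinearMap.toContinuousLinearMap (S.mapQ S (π g : V →ₗ[ℝ] V) (hS g))
  have hσ : ∀ g v, σ g (S.mkQ v) = S.mkQ (π g v) := fun g v => rfl
  refine ⟨{ toFun := σ, map_one' := ?_, map_mul' := ?_ }, hσ⟩
  · ext q
    obtain ⟨v, rfl⟩ := S.mkQ_surjective q
    rw [hσ, map_one]; rfl
  · intro g h
    ext q
    obtain ⟨v, rfl⟩ := S.mkQ_surjective q
    rw [mul_apply_eq_comp, hσ, hσ, hσ, map_mul]; rfl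

/-! ### Induction on dimension through quotients. -/

section induction

universe u

/-- If every nonzero representation of a group contains a conformal subspace, then every
representation has a conformal approximation. -/
theorem exists_conformalApprox {G : Type*} [TopologicalSpace G] [Group G] {F : Set G}
    (hF : IsCompact (closure F))
    (H : ∀ (V : Type u) [NormedAddCommGroup V] [NormedSpace ℝ V] [FiniteDimensional ℝ V]
      [Nontrivial V] (π : G →* (V →L[ℝ] V)), Continuous π →
      ∃ (W : Type) (_ : NormedAddCommGroup W) (_ : NormedSpace ℝ W) (_ : FiniteDimensional ℝ W)
        (_ : Nontrivial W) (j : W →ₗ[ℝ] V) (χ : G → ℝ) (O : G → W ≃ₗᵢ[ℝ] W),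
        Function.Injective j ∧ (∀ g, 0 < χ g) ∧ ∀ g x, π g (j x) = j (χ g • O g x))
    (V : Type u) [NormedAddCommGroup V] [NormedSpace ℝ V] [FiniteDimensional ℝ V]
    (π : G →* (V →L[ℝ] V)) (hπ : Continuous π) :
    ∃ (M : Type) (_ : NormedAddCommGroup M) (_ : NormedSpace ℝ M),
      Nonempty (ConformalApprox π F M) := by
  induction hn : Module.finrank ℝ V using Nat.strong_induction_on generalizing V with
  | _ n ih =>
  rcases subsingleton_or_nontrivial V with hV | hV
  · exact ⟨_, _, _, nonempty_conformalApprox_of_subsingleton π F⟩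
  · obtain ⟨W, _, _, _, _, j, χ, O, hj, hχ, h⟩ := H V π hπ
    let S := LinearMap.range j
    have hSc := S.closed_of_finiteDimensional
    obtain ⟨σ, hσ⟩ := exists_quotient_monoidHom π S (by
      rintro g _ ⟨w, rfl⟩
      exact ⟨_, (h g w).symm⟩)
    have hσc : Continuous σ := by
      refine continuous_clm_apply.2 fun q => ?_
      obtain ⟨v, rfl⟩ := S.mkQ_surjective q
      simp_rw [hσ]
      have := S.mkQ.continuous_of_finiteDimensional
      fun_prop
    have hlt : Module.finrank ℝ (V ⧸ S) < n := by
      have h1 := S.finrank_quotient_add_finrank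
      have h2 : Module.finrank ℝ S = Module.finrank ℝ W := LinearMap.finrank_range_of_inj hj
      have h3 : 0 < Module.finrank ℝ W := Module.finrank_pos
      omega
    obtain ⟨M, _, _, ⟨A⟩⟩ := ih _ hlt (V ⧸ S) σ hσc rfl
    obtain ⟨ℓ, hℓ⟩ := LinearMap.exists_leftInverse_of_injective j (LinearMap.ker_eq_bot.2 hj)
    obtain ⟨s, hs⟩ := LinearMap.exists_rightInverse_of_surjective S.mkQ S.range_mkQ
    have hℓ' : ∀ w, ℓ (j w) = w := fun w => LinearMap.congr_fun hℓ w
    have hs' : ∀ q, S.mkQ (s q) = q := fun q => LinearMap.congr_fun hs q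
    have hmj : ∀ w, S.mkQ (j w) = 0 := fun w => by
      rw [← LinearMap.mem_ker, S.ker_mkQ]
      exact ⟨w, rfl⟩
    have hr : ∀ v, ∃ w, j w = v - s (S.mkQ v) := fun v => by
      have h0 : S.mkQ (v - s (S.mkQ v)) = 0 := by rw [map_sub, hs', sub_self]
      exact (Submodule.Quotient.mk_eq_zero S).1 h0
    -- The left inverse ℓ is precomposed with the projection along the image of s, so that it
    -- vanishes there.
    refine ⟨W × M, _, _, ConformalApprox.nonempty_extension hπ hF hχ h
      (P := ℓ ∘ₗ (LinearMap.id - s ∘ₗ S.mkQ)) (s := s) (m := S.mkQ) (fun w => ?_) hs' hmj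
      (fun q => ?_) (fun v => ?_) (fun g v => (hσ g v).symm) A⟩
    · simp only [LinearMap.comp_apply, LinearMap.sub_apply, LinearMap.id_apply]
      rw [hmj, map_zero, sub_zero, hℓ']
    · simp only [LinearMap.comp_apply, LinearMap.sub_apply, LinearMap.id_apply]
      rw [hs', sub_self, map_zero]
    · obtain ⟨w, hw⟩ := hr v
      simp only [LinearMap.comp_apply, LinearMap.sub_apply, LinearMap.id_apply]
      rw [← hw, hℓ', hw, sub_add_cancel]

end induction

/-! ### Making the torus part volume preserving. -/

section determinant

/-- The unit ball is mapped onto itself, and its volume is scaled by |det O|. -/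
theorem LinearMap.abs_det_eq_one_of_isometry {M : Type*} [NormedAddCommGroup M] [NormedSpace ℝ M]
    [FiniteDimensional ℝ M] (O : M →ₗ[ℝ] M) (hO : ∀ x, ‖O x‖ = ‖x‖) : |LinearMap.det O| = 1 := by
  let _ : MeasurableSpace M := borel M
  have : BorelSpace M := ⟨rfl⟩
  let μ : Measure M := Measure.addHaar
  have hinj : Function.Injective O := by
    rw [← LinearMap.ker_eq_bot, LinearMap.ker_eq_bot']
    intro x hx
    rw [← norm_eq_zero, ← hO, hx, norm_zero]
  have hsurj : Function.Surjective O := LinearMap.surjective_of_injective hinj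
  have hball : O '' Metric.ball 0 1 = Metric.ball 0 1 := by
    ext y
    obtain ⟨x, rfl⟩ := hsurj y
    rw [hinj.mem_set_image, mem_ball_zero_iff, mem_ball_zero_iff, hO]
  have h := Measure.addHaar_image_linearMap μ O (Metric.ball 0 1)
  rw [hball] at h
  have h0 : μ (Metric.ball 0 1) ≠ 0 := (Metric.measure_ball_pos μ 0 one_pos).ne'
  have h1 : μ (Metric.ball 0 1) ≠ ⊤ := measure_ball_lt_top.ne
  have h2 : ENNReal.ofReal |LinearMap.det O| = 1 := by
    rw [eq_comm, ← ENNReal.mul_left_inj h0 h1, one_mul]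
    exact h
  simpa using h2

namespace ConformalApprox

variable {G V : Type*} [NormedAddCommGroup V] [NormedSpace ℝ V]
  {ρ : G → V →L[ℝ] V} {F : Set G} {M : Type*} [NormedAddCommGroup M] [NormedSpace ℝ M]
  (A : ConformalApprox ρ F M)

theorem finiteDimensional [FiniteDimensional ℝ V] (A : ConformalApprox ρ F M) :
    FiniteDimensional ℝ M := by
  obtain ⟨T, -⟩ := A.exists_equiv 1 one_pos
  exact T.finiteDimensional

theorem D_neg_apply (t : Fin A.rank → ℝ) (x : M) : A.D (-t) (A.D t x) = x := by
  rw [← mul_apply_eq_comp, ← A.D_add, neg_add_cancel, A.D_zero]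
  rfl

theorem det_D_add (s t : Fin A.rank → ℝ) : (A.D (s + t)).det = (A.D s).det * (A.D t).det := by
  rw [A.D_add]
  exact map_mul LinearMap.det (A.D s : M →ₗ[ℝ] M) (A.D t)

theorem det_D_zero : (A.D 0).det = 1 := by
  rw [A.D_zero]
  exact map_one LinearMap.det

theorem det_D_ne_zero (t : Fin A.rank → ℝ) : (A.D t).det ≠ 0 := by
  intro h
  have := A.det_D_add t (-t)
  rw [add_neg_cancel, A.det_D_zero, h, zero_mul] at this
  exact one_ne_zero this

/-- The conjugates of ρ g by T converge to the model operator as ε tends to 0, and the determinant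
is continuous and conjugation invariant. -/
theorem det_eq [FiniteDimensional ℝ V] {g : G} (hg : g ∈ F) :
    (A.D (A.a g) * A.O g).det = (ρ g).det := by
  have := A.finiteDimensional
  choose T hT using fun n : ℕ => A.exists_equiv (1 / ((n : ℝ) + 1)) (by positivity)
  let S : ℕ → M →L[ℝ] M := fun n =>
    LinearMap.toContinuousLinearMap ((T n : V →ₗ[ℝ] M) ∘ₗ (ρ g : V →ₗ[ℝ] V) ∘ₗ (T n).symm)
  have hS : Tendsto S atTop (𝓝 (A.D (A.a g) * A.O g)) := by
    rw [tendsto_iff_norm_sub_tendsto_zero]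
    refine squeeze_zero (fun _ => norm_nonneg _) (fun n => ?_) tendsto_one_div_add_atTop_nhds_zero_nat
    refine ContinuousLinearMap.opNorm_le_bound _ (by positivity) fun x => ?_
    have := hT n g hg ((T n).symm x)
    rwa [LinearEquiv.apply_symm_apply] at this
  have hd := (ContinuousLinearMap.continuous_det.tendsto _).comp hS
  refine tendsto_nhds_unique hd (tendsto_const_nhds.congr fun n => ?_)
  exact (LinearMap.det_conj (ρ g : V →ₗ[ℝ] V) (T n)).symm

theorem abs_det_D_a [FiniteDimensional ℝ V] {g : G} (hg : g ∈ F)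
    (h : |(ρ g).det| = 1) : |(A.D (A.a g)).det| = 1 := by
  have := A.finiteDimensional
  have h1 : (A.D (A.a g) * A.O g).det = (A.D (A.a g)).det * (A.O g).det :=
    map_mul LinearMap.det (A.D (A.a g) : M →ₗ[ℝ] M) (A.O g)
  have h2 : |(A.O g).det| = 1 := LinearMap.abs_det_eq_one_of_isometry _ (A.norm_O g)
  rw [← A.det_eq hg, h1, abs_mul, h2, mul_one] at h
  exact h

/-- For operators of determinant `±1` the torus part of a conformal approximation can be chosen
volume preserving. -/
theorem exists_abs_det_eq_one [FiniteDimensional ℝ V] (A : ConformalApprox ρ F M)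
    (h : ∀ g ∈ F, |(ρ g).det| = 1) :
    ∃ B : ConformalApprox ρ F M, ∀ t, |(B.D t).det| = 1 := by
  have := A.finiteDimensional
  -- Multiplying D by κ normalises all determinants; since κ = 1 at each a g with g ∈ F, the
  -- approximation is unaffected.
  let κ : (Fin A.rank → ℝ) → ℝ := fun t => |(A.D t).det| ^ (-(1 / (Module.finrank ℝ M : ℝ)))
  have hκ0 : ∀ t, 0 ≤ κ t := fun t => by positivity
  have hκc : Continuous κ :=
    (ContinuousLinearMap.continuous_det.comp A.continuous_D).abs.rpow_const
      fun t => Or.inl (abs_pos.2 (A.det_D_ne_zero t)).ne'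
  have hκadd : ∀ s t, κ (s + t) = κ s * κ t := fun s t => by
    simp only [κ]
    rw [A.det_D_add, abs_mul, Real.mul_rpow (abs_nonneg _) (abs_nonneg _)]
  have hκa : ∀ g ∈ F, κ (A.a g) = 1 := fun g hg => by
    simp only [κ]
    rw [A.abs_det_D_a hg (h g hg), Real.one_rpow]
  refine ⟨{
    rank := A.rank
    D := fun t => κ t • A.D t
    O := A.O
    a := A.a
    bound := A.bound
    continuous_D := hκc.smul A.continuous_D
    D_zero := by
      simp only [κ]
      rw [A.det_D_zero, abs_one, Real.one_rpow, one_smul, A.D_zero]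
    D_add := fun s t => by rw [hκadd, A.D_add, smul_mul_smul_comm]
    norm_O := A.norm_O
    O_D := fun g t x => by simp [A.O_D]
    abs_a_le := A.abs_a_le
    exists_equiv := fun ε hε => ?_ }, fun t => ?_⟩
  · obtain ⟨T, hT⟩ := A.exists_equiv ε hε
    refine ⟨T, fun g hg v => ?_⟩
    rw [hκa g hg, one_smul]
    exact hT g hg v
  · have h1 : (κ t • A.D t).det = κ t ^ Module.finrank ℝ M * (A.D t).det :=
      LinearMap.det_smul (κ t) (A.D t : M →ₗ[ℝ] M)
    change |(κ t • A.D t).det| = 1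
    rw [h1, abs_mul, abs_pow, abs_of_nonneg (hκ0 t)]
    rcases Nat.eq_zero_or_pos (Module.finrank ℝ M) with h0 | h0
    · have h2 : (A.D t).det = 1 := LinearMap.det_eq_one_of_finrank_eq_zero h0 _
      rw [h0, h2]
      simp
    · have hd := abs_pos.2 (A.det_D_ne_zero t)
      simp only [κ]
      rw [← Real.rpow_natCast, ← Real.rpow_mul hd.le, neg_mul, one_div,
        inv_mul_cancel₀ (by positivity), Real.rpow_neg_one, inv_mul_cancel₀ hd.ne']

end ConformalApprox

end determinant

/-! ### Polynomial growth of tubes. -/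

section growth

/-- A sequence of polynomial growth does not grow by a fixed factor at every step. -/
theorem exists_mul_succ_le_of_polynomial_growth {f : ℕ → ℝ} (h0 : 0 < f 0) {C : ℝ} {p : ℕ}
    (hf : ∀ k, f k ≤ C * ((k : ℝ) + 1) ^ p) {c : ℝ} (hc0 : 0 < c) (hc1 : c < 1) :
    ∃ k, c * f (k + 1) ≤ f k := by
  by_contra! h
  have h1 : ∀ k, f 0 ≤ c ^ k * f k := by
    intro k
    induction k with
    | zero => simp
    | succ k ih =>
      refine ih.trans ?_
      rw [pow_succ, mul_assoc]
      exact mul_le_mul_of_nonneg_left (h k).le (by positivity)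
  have h2 := (tendsto_pow_const_mul_const_pow_of_abs_lt_one p
    (by rwa [abs_of_pos hc0] : |c| < 1)).comp (tendsto_add_atTop_nat 1)
  -- Dividing by c compensates for the shift from k to k + 1 in the exponent of c.
  have h3 := h2.const_mul (C / c)
  rw [mul_zero] at h3
  have h4 : f 0 ≤ 0 := by
    refine ge_of_tendsto' h3 fun k => (h1 k).trans ?_
    calc c ^ k * f k ≤ c ^ k * (C * ((k : ℝ) + 1) ^ p) := by gcongr; exact hf k
      _ = _ := by
        simp only [Function.comp_apply, Nat.cast_add, Nat.cast_one, pow_succ]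
        field_simp
  exact absurd h0 (not_lt.2 h4)

namespace ConformalApprox

variable {G V : Type*} [NormedAddCommGroup V] [NormedSpace ℝ V]
  {ρ : G → V →L[ℝ] V} {F : Set G} {M : Type*} [NormedAddCommGroup M] [NormedSpace ℝ M]
  (A : ConformalApprox ρ F M)

/-- The union of the images of the ball of radius `r` under the torus elements of size at
most `N`. -/
def tube (N r : ℝ) : Set M := {x | ∃ t, (∀ i, |t i| ≤ N) ∧ ‖A.D t x‖ < r}

theorem isOpen_tube (N r : ℝ) : IsOpen (A.tube N r) := by
  have : A.tube N r = ⋃ (t) (_ : ∀ i, |t i| ≤ N), {x | ‖A.D t x‖ < r} := by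
    ext x; simp [tube]
  rw [this]
  exact isOpen_iUnion fun t => isOpen_iUnion fun _ =>
    isOpen_lt (A.D t).continuous.norm continuous_const

theorem zero_mem_tube {N r : ℝ} (hN : 0 ≤ N) (hr : 0 < r) : (0 : M) ∈ A.tube N r :=
  ⟨0, by simpa using fun _ => hN, by simpa using hr⟩

theorem balanced_tube (N r : ℝ) : Balanced ℝ (A.tube N r) := by
  rw [balanced_iff_smul_mem]
  rintro α hα x ⟨t, ht, hx⟩
  refine ⟨t, ht, ?_⟩
  rw [map_smul, norm_smul]
  exact (mul_le_of_le_one_left (norm_nonneg _) hα).trans_lt hx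

theorem exists_norm_D_le (N : ℝ) : ∃ K, 0 < K ∧ ∀ t, (∀ i, |t i| ≤ N) → ‖A.D t‖ ≤ K := by
  rcases lt_or_ge N 0 with hN | hN
  · obtain h0 | h0 := isEmpty_or_nonempty (Fin A.rank)
    · exact ⟨‖A.D 0‖ + 1, by positivity, fun t _ => by rw [Subsingleton.elim t 0]; simp⟩
    · exact ⟨1, one_pos, fun t ht => absurd (ht h0.some) (by
        have := abs_nonneg (t h0.some); linarith)⟩
  · obtain ⟨K, hK⟩ := (isCompact_closedBall (0 : Fin A.rank → ℝ) N).exists_bound_of_continuousOn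
      A.continuous_D.continuousOn
    refine ⟨max K 1, by positivity, fun t ht => (hK t ?_).trans (le_max_left _ _)⟩
    rw [mem_closedBall_zero_iff, pi_norm_le_iff_of_nonneg hN]
    exact ht

theorem isBounded_tube (N r : ℝ) : Bornology.IsBounded (A.tube N r) := by
  obtain ⟨K, hK0, hK⟩ := A.exists_norm_D_le N
  refine isBounded_iff_forall_norm_le.2 ⟨K * r, ?_⟩
  rintro x ⟨t, ht, hx⟩
  have h1 : ‖A.D (-t)‖ ≤ K := hK _ (by simpa using ht)
  calc ‖x‖ = ‖A.D (-t) (A.D t x)‖ := by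
        rw [← mul_apply_eq_comp, ← A.D_add, neg_add_cancel, A.D_zero]; rfl
    _ ≤ ‖A.D (-t)‖ * ‖A.D t x‖ := (A.D (-t)).le_opNorm _
    _ ≤ K * r := by gcongr

theorem tube_eq_smul (N : ℝ) {r : ℝ} (hr : 0 < r) : A.tube N r = r • A.tube N 1 := by
  ext x
  rw [mem_smul_set_iff_inv_smul_mem₀ hr.ne']
  simp only [tube, mem_ofPred_eq, map_smul, norm_smul, norm_inv, Real.norm_of_nonneg hr.le,
    inv_mul_lt_iff₀ hr, mul_one]

variable [MeasurableSpace M] (μ : Measure M) [μ.IsAddHaarMeasure]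

theorem measure_tube_lt_top [FiniteDimensional ℝ M] (N r : ℝ) : μ (A.tube N r) < ⊤ :=
  (A.isBounded_tube N r).measure_lt_top

theorem measure_tube_pos {N r : ℝ} (hN : 0 ≤ N) (hr : 0 < r) : 0 < μ (A.tube N r) :=
  (A.isOpen_tube N r).measure_pos μ ⟨0, A.zero_mem_tube hN hr⟩

/-- Splitting t into integer and fractional parts covers the tube by preimages of the unit tube
under D n, all of equal volume. The integer vectors range over a box of side 2N + 3. -/
theorem measure_tube_le [FiniteDimensional ℝ M] [BorelSpace M]
    (hA : ∀ t, |(A.D t).det| = 1) (N : ℕ) :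
    μ (A.tube N 1) ≤ (2 * N + 3 : ℕ) ^ A.rank * μ (A.tube 1 1) := by
  let I : Finset (Fin A.rank → ℤ) :=
    Fintype.piFinset fun _ => Finset.Icc (-(N + 1 : ℕ) : ℤ) (N + 1 : ℕ)
  have hI : I.card = (2 * N + 3) ^ A.rank := by
    simp only [I, Fintype.card_piFinset, Int.card_Icc, Finset.prod_const, Finset.card_univ,
      Fintype.card_fin]
    congr 1
    omega
  have hsub : A.tube N 1 ⊆ ⋃ n ∈ I, A.D (fun i => (n i : ℝ)) ⁻¹' A.tube 1 1 := by
    rintro x ⟨t, ht, hx⟩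
    simp only [mem_iUnion]
    refine ⟨fun i => ⌊t i⌋, ?_, fun i => Int.fract (t i), fun i => ?_, ?_⟩
    · rw [Fintype.mem_piFinset]
      intro i
      have h1 := abs_le.1 (ht i)
      rw [Finset.mem_Icc]
      constructor
      · rw [Int.le_floor]; push_cast; linarith
      · have := Int.floor_le (t i)
        have h2 : (⌊t i⌋ : ℝ) ≤ ((N + 1 : ℕ) : ℤ) := by push_cast; linarith
        exact_mod_cast h2
    · rw [abs_of_nonneg (Int.fract_nonneg _)]
      exact (Int.fract_lt_one _).le
    · rw [← mul_apply_eq_comp, ← A.D_add]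
      convert hx using 4
      ext i
      exact Int.fract_add_floor (t i)
  calc μ (A.tube N 1) ≤ μ (⋃ n ∈ I, A.D (fun i => (n i : ℝ)) ⁻¹' A.tube 1 1) := measure_mono hsub
    _ ≤ ∑ n ∈ I, μ (A.D (fun i => (n i : ℝ)) ⁻¹' A.tube 1 1) := measure_biUnion_finset_le _ _
    _ = ∑ n ∈ I, μ (A.tube 1 1) := by
      refine Finset.sum_congr rfl fun n _ => ?_
      have h1 : (A.D fun i => (n i : ℝ)).det ≠ 0 := fun h0 => by
        have := hA fun i => (n i : ℝ)
        simp [h0] at this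
      have h2 := Measure.addHaar_preimage_linearMap μ
        (f := (A.D fun i => (n i : ℝ) : M →ₗ[ℝ] M)) h1 (A.tube 1 1)
      refine h2.trans ?_
      have h3 : |(LinearMap.det (A.D fun i => (n i : ℝ) : M →ₗ[ℝ] M))⁻¹| = 1 := by
        rw [abs_inv, inv_eq_one]
        exact hA _
      rw [h3, ENNReal.ofReal_one, one_mul]
    _ = _ := by rw [Finset.sum_const, hI, nsmul_eq_mul]; push_cast; rfl

/-- Along multiples of L the volumes grow polynomially, so some step grows by a factor of at most
1/c. -/
theorem exists_measure_tube_add_le [FiniteDimensional ℝ M] [BorelSpace M]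
    (hA : ∀ t, |(A.D t).det| = 1) (L : ℕ) {c : ℝ} (hc0 : 0 < c)
    (hc1 : c < 1) :
    ∃ N : ℕ, ENNReal.ofReal c * μ (A.tube (N + L : ℕ) 1) ≤ μ (A.tube N 1) := by
  have hfin : ∀ N : ℕ, μ (A.tube N 1) ≠ ⊤ := fun N => (A.measure_tube_lt_top μ N 1).ne
  have h0 : 0 < (μ (A.tube (0 * L : ℕ) 1)).toReal :=
    ENNReal.toReal_pos (A.measure_tube_pos μ (by positivity) one_pos).ne' (hfin _)
  have hf : ∀ k : ℕ, (μ (A.tube (k * L : ℕ) 1)).toReal ≤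
      (2 * L + 3 : ℝ) ^ A.rank * (μ (A.tube 1 1)).toReal * ((k : ℝ) + 1) ^ A.rank := by
    intro k
    have h1 := ENNReal.toReal_mono (ENNReal.mul_ne_top (ENNReal.pow_ne_top (ENNReal.natCast_ne_top _))
      (A.measure_tube_lt_top μ 1 1).ne) (A.measure_tube_le μ hA (k * L))
    refine h1.trans ?_
    rw [ENNReal.toReal_mul, ENNReal.toReal_pow, ENNReal.toReal_natCast, mul_right_comm, ← mul_pow]
    gcongr
    push_cast
    have : (0 : ℝ) ≤ L := by positivity
    have : (0 : ℝ) ≤ k := by positivity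
    nlinarith
  obtain ⟨k, hk⟩ := exists_mul_succ_le_of_polynomial_growth
    (f := fun k => (μ (A.tube (k * L : ℕ) 1)).toReal) h0 hf hc0 hc1
  refine ⟨k * L, ?_⟩
  rw [← ENNReal.toReal_le_toReal (ENNReal.mul_ne_top ENNReal.ofReal_ne_top (hfin _)) (hfin _),
    ENNReal.toReal_mul, ENNReal.toReal_ofReal hc0.le]
  simpa [Nat.succ_mul] using hk

end ConformalApprox

end growth

/-! ### Nearly invariant balanced sets. -/

section nearlyInvariant

namespace ConformalApprox

variable {G V : Type*} [NormedAddCommGroup V] [NormedSpace ℝ V]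
  {ρ : G → V →L[ℝ] V} {F : Set G} {M : Type*} [NormedAddCommGroup M] [NormedSpace ℝ M]
  (A : ConformalApprox ρ F M)

/-- Slightly shrunken tubes are mapped into larger tubes by small perturbations of the model
operators. -/
theorem exists_pos_mem_tube (N : ℝ) {s : ℝ} (hs1 : s < 1) :
    ∃ ε > 0, ∀ g ∈ F, ∀ x ∈ A.tube N s, ∀ y, ‖y - A.D (A.a g) (A.O g x)‖ ≤ ε * ‖x‖ →
      y ∈ A.tube (N + A.bound) 1 := by
  obtain ⟨K, hK0, hK⟩ := A.exists_norm_D_le (N + A.bound)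
  obtain ⟨K', hK0', hK'⟩ := A.exists_norm_D_le N
  -- K' bounds the tube and K the operators D (t − a g), so the perturbation contributes at most 1 −
  -- s.
  refine ⟨(1 - s) / (K * K'), div_pos (by linarith) (by positivity), ?_⟩
  rintro g hg x ⟨t, ht, hx⟩ y hy
  have hτ : ∀ i, |(t + -A.a g) i| ≤ N + A.bound := fun i => by
    refine (abs_add_le _ _).trans (add_le_add (ht i) ?_)
    rw [Pi.neg_apply, abs_neg]
    exact A.abs_a_le g hg i
  refine ⟨_, hτ, ?_⟩
  have hxK : ‖x‖ ≤ K' := by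
    have h1 : ‖A.D (-t)‖ ≤ K' := hK' _ (by simpa using ht)
    calc ‖x‖ = ‖A.D (-t) (A.D t x)‖ := by rw [A.D_neg_apply]
      _ ≤ ‖A.D (-t)‖ * ‖A.D t x‖ := (A.D (-t)).le_opNorm _
      _ ≤ K' * 1 := by gcongr; exact hx.le.trans hs1.le
      _ = K' := mul_one _
  -- The shift by −a g undoes D (a g), and O g commutes with D; the unperturbed point lands in the
  -- ball of radius s.
  have h1 : A.D (t + -A.a g) (A.D (A.a g) (A.O g x)) = A.O g (A.D t x) := by
    rw [A.O_D, A.D_add, mul_apply_eq_comp, A.D_neg_apply]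
  have h2 : A.D (t + -A.a g) y = A.O g (A.D t x) +
      A.D (t + -A.a g) (y - A.D (A.a g) (A.O g x)) := by
    rw [map_sub, h1, add_sub_cancel]
  rw [h2]
  calc _ ≤ ‖A.O g (A.D t x)‖ + ‖A.D (t + -A.a g) (y - A.D (A.a g) (A.O g x))‖ := norm_add_le _ _
    _ ≤ ‖A.D t x‖ + K * ((1 - s) / (K * K') * K') := by
        rw [A.norm_O]
        gcongr
        refine (A.D _).le_of_opNorm_le_of_le (hK _ hτ) (hy.trans ?_)
        gcongr
    _ = ‖A.D t x‖ + (1 - s) := by field_simp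
    _ < 1 := by linarith

end ConformalApprox

/-- Bernoulli's inequality with s = 1 − (1 − c)/(d + 1). -/
theorem exists_lt_one_le_pow {c : ℝ} (hc0 : 0 < c) (hc1 : c < 1) (d : ℕ) :
    ∃ s, 0 < s ∧ s < 1 ∧ c ≤ s ^ d := by
  have hd : (0 : ℝ) < (d : ℝ) + 1 := by positivity
  have h1 : (1 - c) / ((d : ℝ) + 1) ≤ 1 - c := div_le_self (by linarith) (by linarith [d.cast_nonneg (α := ℝ)])
  have h0 : 0 < (1 - c) / ((d : ℝ) + 1) := div_pos (by linarith) hd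
  refine ⟨1 + -((1 - c) / (d + 1)), by linarith, by linarith, ?_⟩
  refine le_trans ?_ (one_add_mul_le_pow (by linarith) d)
  have h2 : (d : ℝ) * ((1 - c) / (d + 1)) ≤ 1 - c := by
    rw [mul_div_assoc', div_le_iff₀ hd]
    nlinarith
  linarith

/-- If the operators `ρ g` have determinant `±1` and a conformal approximation, then there are
balanced open sets that are nearly invariant under all `ρ g`, `g ∈ F`. -/
theorem ConformalApprox.exists_nearly_invariant {G V M : Type*} [Group G] [NormedAddCommGroup V]
    [NormedSpace ℝ V] [FiniteDimensional ℝ V] [MeasurableSpace V] [BorelSpace V] (Λ : Measure V)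
    [Λ.IsAddHaarMeasure] [NormedAddCommGroup M] [NormedSpace ℝ M] {ρ : G →* (V →L[ℝ] V)}
    {F : Set G} (hF : F⁻¹ = F) (hdet : ∀ g ∈ F, |(ρ g).det| = 1) (A : ConformalApprox ρ F M)
    {c : ℝ} (hc0 : 0 < c) (hc1 : c < 1) :
    ∃ U : Set V, IsOpen U ∧ (0 : V) ∈ U ∧ Bornology.IsBounded U ∧ Balanced ℝ U ∧
      ENNReal.ofReal c * (ENNReal.ofReal c * Λ U) ≤ Λ (⋂ g ∈ F, ρ g '' U) := by
  have := A.finiteDimensional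
  obtain ⟨B, hB⟩ := A.exists_abs_det_eq_one hdet
  let _ : MeasurableSpace M := borel M
  have : BorelSpace M := ⟨rfl⟩
  obtain ⟨L, hL⟩ := exists_nat_ge B.bound
  obtain ⟨N, hN⟩ := B.exists_measure_tube_add_le Measure.addHaar hB L hc0 hc1
  obtain ⟨s, hs0, hs1, hs⟩ := exists_lt_one_le_pow hc0 hc1 (Module.finrank ℝ M)
  obtain ⟨ε, hε, h⟩ := B.exists_pos_mem_tube N hs1
  obtain ⟨T, hT⟩ := B.exists_equiv ε hε
  let T' : V ≃L[ℝ] M := T.toContinuousLinearEquiv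
  have hTT' : ∀ v, T' v = T v := fun _ => rfl
  have hmono : B.tube (N + B.bound) 1 ⊆ B.tube (N + L : ℕ) 1 := by
    rintro x ⟨t, ht, hx⟩
    exact ⟨t, fun i => (ht i).trans (by push_cast; linarith), hx⟩
  refine ⟨T' ⁻¹' B.tube (N + L : ℕ) 1, (B.isOpen_tube _ _).preimage T'.continuous, ?_, ?_, ?_, ?_⟩
  · rw [mem_preimage, map_zero]
    exact B.zero_mem_tube (by positivity) one_pos
  · rw [← T'.image_symm_eq_preimage]
    exact T'.symm.lipschitz.isBounded_image (B.isBounded_tube _ _)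
  · rw [balanced_iff_smul_mem]
    intro α hα x hx
    rw [mem_preimage, map_smul]
    exact (B.balanced_tube _ _).smul_mem hα hx
  · have hsub : T' ⁻¹' B.tube N s ⊆ ⋂ g ∈ F, ρ g '' (T' ⁻¹' B.tube (N + L : ℕ) 1) := by
      intro v hv
      simp only [mem_iInter]
      intro g hg
      have hg' : g⁻¹ ∈ F := by rw [← hF]; exact Set.inv_mem_inv.2 hg
      refine ⟨ρ g⁻¹ v, hmono (h g⁻¹ hg' _ hv _ (hT g⁻¹ hg' v)), ?_⟩
      rw [← mul_apply_eq_comp, ← map_mul, mul_inv_cancel, map_one]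
      rfl
    refine le_trans ?_ (measure_mono hsub)
    have hme : ∀ X : Set M, Λ (T' ⁻¹' X) = Λ.map T' X := fun X =>
      (T'.toHomeomorph.toMeasurableEquiv.map_apply X).symm
    have hH : (Λ.map T').IsAddHaarMeasure := T'.isAddHaarMeasure_map Λ
    -- Volumes may be compared in M by uniqueness of Haar measure. One factor c pays for shrinking
    -- the radius to s, the other for enlarging N to N + L.
    rw [hme, hme, Measure.isAddLeftInvariant_eq_smul (Λ.map T') Measure.addHaar]
    simp only [Measure.smul_apply]
    rw [B.tube_eq_smul _ hs0, Measure.addHaar_smul, abs_of_pos (pow_pos hs0 _)]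
    simp only [ENNReal.smul_def, smul_eq_mul]
    calc _ = Measure.addHaarScalarFactor (Λ.map T') Measure.addHaar * (ENNReal.ofReal c *
          (ENNReal.ofReal c * Measure.addHaar (B.tube (N + L : ℕ) 1))) := by ring
      _ ≤ _ := by gcongr

end nearlyInvariant

/-! ### The upper bound, and bases made of dilates. -/

section deltaBar

namespace LocalDeLeeuw

variable {G V : Type*} [NormedAddCommGroup V] [NormedSpace ℝ V] [MeasurableSpace V]
  (Λ : Measure V) {ρ : G → V →ₗ[ℝ] V} {F : Set G}

/-- The intersection lies in a single ρ g '' U, whose volume is that of U. -/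
theorem deltaSet_le_one [BorelSpace V] [FiniteDimensional ℝ V] [Λ.IsAddHaarMeasure]
    (hF : F.Nonempty) (hdet : ∀ g ∈ F, |LinearMap.det (ρ g)| = 1) (U : Set V) :
    deltaSet Λ ρ F U ≤ 1 := by
  obtain ⟨g, hg⟩ := hF
  have h1 : Λ (⋂ g ∈ F, ρ g '' U) ≤ Λ U := by
    refine (measure_mono (biInter_subset_of_mem hg)).trans ?_
    rw [Measure.addHaar_image_linearMap, hdet g hg, ENNReal.ofReal_one, one_mul]
  exact (ENNReal.div_le_div_right h1 _).trans ENNReal.div_self_le_one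

/-- Without this the limit inferior would be over the trivial filter and equal ⊤. -/
theorem IsBalancedOpenBasis.neBot {V : Type*} [NormedAddCommGroup V] [NormedSpace ℝ V]
    {𝒱 : Set (Set V)} (h𝒱 : IsBalancedOpenBasis 𝒱) :
    ((𝓝 (0 : V)).smallSets ⊓ 𝓟 𝒱).NeBot := by
  rw [inf_principal_neBot_iff]
  intro S hS
  obtain ⟨t, ht, htS⟩ := (mem_lift'_sets monotone_powerset).1 hS
  obtain ⟨W, hW, hWt⟩ := h𝒱.hasBasis.mem_iff.1 ht
  exact ⟨W, htS hWt, hW⟩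

theorem deltaBasis_le_one [BorelSpace V] [FiniteDimensional ℝ V] [Λ.IsAddHaarMeasure]
    (hF : F.Nonempty) (hdet : ∀ g ∈ F, |LinearMap.det (ρ g)| = 1) {𝒱 : Set (Set V)}
    (h𝒱 : IsBalancedOpenBasis 𝒱) : deltaBasis Λ ρ F 𝒱 ≤ 1 := by
  have := h𝒱.neBot
  refine (liminf_le_liminf (v := fun _ => (1 : ℝ≥0∞))
    (Eventually.of_forall fun U => deltaSet_le_one Λ hF hdet U)).trans ?_
  rw [liminf_const]

/-- Linear maps commute with dilations, which scale numerator and denominator by the same power of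
c. -/
theorem deltaSet_smul_ge [BorelSpace V] [FiniteDimensional ℝ V] [Λ.IsAddHaarMeasure]
    (U : Set V) {c : ℝ} (hc : 0 < c) : deltaSet Λ ρ F U ≤ deltaSet Λ ρ F (c • U) := by
  have h1 : c • (⋂ g ∈ F, ρ g '' U) ⊆ ⋂ g ∈ F, ρ g '' (c • U) := by
    rintro _ ⟨x, hx, rfl⟩
    simp only [mem_iInter] at hx ⊢
    intro g hg
    obtain ⟨u, hu, hux⟩ := hx g hg
    exact ⟨c • u, smul_mem_smul_set hu, by rw [map_smul, hux]⟩
  have hk0 : ENNReal.ofReal |c ^ Module.finrank ℝ V| ≠ 0 := by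
    rw [Ne, ENNReal.ofReal_eq_zero, not_le]
    positivity
  have h2 := measure_mono (μ := Λ) h1
  rw [Measure.addHaar_smul] at h2
  rw [deltaSet, deltaSet, Measure.addHaar_smul,
    ← ENNReal.mul_div_mul_left _ (Λ U) hk0 ENNReal.ofReal_ne_top]
  exact ENNReal.div_le_div_right h2 _

/-- The rescalings of a single set are enough to make up a neighbourhood basis. -/
theorem exists_basis_le_deltaBasis [BorelSpace V] [FiniteDimensional ℝ V] [Λ.IsAddHaarMeasure]
    {U : Set V} (hU : IsOpen U) (h0 : (0 : V) ∈ U) (hb : Bornology.IsBounded U)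
    (hbal : Balanced ℝ U) :
    ∃ 𝒱 : Set (Set V), IsBalancedOpenBasis 𝒱 ∧ deltaSet Λ ρ F U ≤ deltaBasis Λ ρ F 𝒱 := by
  refine ⟨{W | ∃ c : ℝ, 0 < c ∧ W = c • U}, ⟨⟨fun t => ⟨fun ht => ?_, ?_⟩⟩, ?_, ?_, ?_⟩, ?_⟩
  · obtain ⟨ε, hε, hεt⟩ := Metric.mem_nhds_iff.1 ht
    obtain ⟨K, hK0, hK⟩ := hb.exists_pos_norm_le
    refine ⟨_, ⟨ε / (2 * K), by positivity, rfl⟩, ?_⟩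
    rintro _ ⟨u, hu, rfl⟩
    apply hεt
    rw [mem_ball_zero_iff]
    simp only [norm_smul]
    rw [Real.norm_of_nonneg (by positivity)]
    calc ε / (2 * K) * ‖u‖ ≤ ε / (2 * K) * K := by gcongr; exact hK u hu
      _ = ε / 2 := by field_simp
      _ < ε := by linarith
  · rintro ⟨_, ⟨c, hc, rfl⟩, hcU⟩
    refine mem_of_superset ((hU.smul₀ hc.ne').mem_nhds ?_) hcU
    exact ⟨0, h0, smul_zero c⟩
  · rintro _ ⟨c, hc, rfl⟩
    exact hU.smul₀ hc.ne'
  · rintro _ ⟨c, hc, rfl⟩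
    exact (hb.smul₀ c).isCompact_closure
  · rintro _ ⟨c, hc, rfl⟩
    rw [balanced_iff_smul_mem] at hbal ⊢
    rintro α hα _ ⟨u, hu, rfl⟩
    refine ⟨α • u, hbal hα hu, smul_comm c α u⟩
  · refine le_liminf_of_le (by isBoundedDefault) (mem_inf_of_right ?_)
    rw [mem_principal]
    rintro _ ⟨c, hc, rfl⟩
    exact deltaSet_smul_ge Λ U hc

end LocalDeLeeuw

end deltaBar

/-! ### The rescaled representation. -/

section rescaled

variable {G V : Type*} [Group G] [TopologicalSpace G] [NormedAddCommGroup V] [NormedSpace ℝ V]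
  [FiniteDimensional ℝ V]

theorem Representation.continuous_toContinuousLinearMap {π : Representation ℝ G V}
    (hπ : Continuous fun p : G × V => π p.1 p.2) :
    Continuous fun g => LinearMap.toContinuousLinearMap (π g) :=
  continuous_clm_apply.2 fun _ => hπ.comp (continuous_id.prodMk continuous_const)

theorem Representation.continuous_det {π : Representation ℝ G V}
    (hπ : Continuous fun p : G × V => π p.1 p.2) : Continuous fun g => LinearMap.det (π g) :=
  ContinuousLinearMap.continuous_det.comp (continuous_toContinuousLinearMap hπ)

/-- The determinant is continuous, never zero and equal to 1 at the identity; connectedness excludes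
a sign change. -/
theorem Representation.det_pos [ConnectedSpace G] {π : Representation ℝ G V}
    (hπ : Continuous fun p : G × V => π p.1 p.2) (g : G) : 0 < LinearMap.det (π g) := by
  by_contra! h
  obtain ⟨x, hx⟩ := mem_range_of_exists_le_of_exists_ge (continuous_det hπ) ⟨g, h⟩
    ⟨1, by simp⟩
  have h1 : LinearMap.det (π x) * LinearMap.det (π x⁻¹) = 1 := by
    rw [← map_mul, ← map_mul, mul_inv_cancel, map_one, map_one]
  simp only at hx
  rw [hx, zero_mul] at h1
  exact zero_ne_one h1

theorem LocalDeLeeuw.det_rescaled {G : Type*} [Group G] {π : Representation ℝ G V} {g : G}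
    (h : 0 < LinearMap.det (π g)) : LinearMap.det (LocalDeLeeuw.rescaled π g) = 1 := by
  rw [LocalDeLeeuw.rescaled, LinearMap.det_smul]
  rcases Nat.eq_zero_or_pos (Module.finrank ℝ V) with h0 | h0
  · rw [LinearMap.det_eq_one_of_finrank_eq_zero h0]
    simp
  · rw [← Real.rpow_natCast, ← Real.rpow_mul h.le, neg_mul, one_div,
      inv_mul_cancel₀ (by positivity), Real.rpow_neg_one, inv_mul_cancel₀ h.ne']

/-- The rescaled representation as a continuous homomorphism. -/
theorem LocalDeLeeuw.exists_rescaled_monoidHom [ConnectedSpace G] {π : Representation ℝ G V}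
    (hπ : Continuous fun p : G × V => π p.1 p.2) :
    ∃ ρ : G →* (V →L[ℝ] V), Continuous ρ ∧ ∀ g, (ρ g : V →ₗ[ℝ] V) = rescaled π g := by
  have hpos := Representation.det_pos hπ
  refine ⟨{
    toFun := fun g => LinearMap.toContinuousLinearMap (rescaled π g)
    map_one' := ?_
    map_mul' := fun g h => ?_ }, ?_, fun g => rfl⟩
  · ext v
    simp [rescaled]
  · ext v
    simp only [rescaled, map_mul, Real.mul_rpow (hpos g).le (hpos h).le]
    change ((_ : ℝ) * (_ : ℝ)) • π g (π h v) = (_ : ℝ) • π g ((_ : ℝ) • π h v)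
    rw [map_smul, smul_smul]
  · have h1 : Continuous fun g => LinearMap.det (π g) ^ (-(1 / (Module.finrank ℝ V : ℝ))) :=
      (Representation.continuous_det hπ).rpow_const fun g => Or.inl (hpos g).ne'
    have h2 := h1.smul (Representation.continuous_toContinuousLinearMap hπ)
    exact h2

end rescaled

/-! ### Conclusion. -/

theorem mainTheorem2
    {E : Type*} [NormedAddCommGroup E] [NormedSpace ℝ E] [FiniteDimensional ℝ E]
    {R : Type*} [TopologicalSpace R] [ChartedSpace E R] [Group R]
    [LieGroup 𝓘(ℝ, E) ∞ R] [ConnectedSpace R]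
    (hR : LieAlgebra.IsSolvable (GroupLieAlgebra 𝓘(ℝ, E) R))
    (F : Set R) (hFne : F.Nonempty) (hFc : IsCompact (closure F)) (hFs : F⁻¹ = F)
    {V : Type*} [NormedAddCommGroup V] [NormedSpace ℝ V] [FiniteDimensional ℝ V]
    [MeasurableSpace V] [BorelSpace V] (Λ : Measure V) [Λ.IsAddHaarMeasure]
    (π : Representation ℝ R V) (hπ : Continuous fun p : R × V => π p.1 p.2) :
    LocalDeLeeuw.deltaBar Λ π F = 1 := by
  have hdet : ∀ g, LinearMap.det (LocalDeLeeuw.rescaled π g) = 1 := fun g =>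
    LocalDeLeeuw.det_rescaled (Representation.det_pos hπ g)
  have hdet' : ∀ g ∈ F, |LinearMap.det (LocalDeLeeuw.rescaled π g)| = 1 := fun g _ => by
    rw [hdet, abs_one]
  refine le_antisymm (iSup₂_le fun 𝒱 h𝒱 =>
    LocalDeLeeuw.deltaBasis_le_one Λ hFne hdet' h𝒱) (le_of_forall_lt fun r hr => ?_)
  obtain ⟨ρ, hρc, hρ⟩ := LocalDeLeeuw.exists_rescaled_monoidHom hπ
  obtain ⟨M, _, _, ⟨A⟩⟩ := exists_conformalApprox hFc
    (fun V _ _ _ _ π hπ => exists_conformal_subspace hR π hπ) V ρ hρc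
  -- The intermediate r' is positive even when r = 0, so c can be taken as its square root, with 0 <
  -- c < 1 and c² = r'.
  obtain ⟨r', hrr', hr'1⟩ := exists_between hr
  obtain ⟨c, hc0, hc1, hrc⟩ : ∃ c : ℝ, 0 < c ∧ c < 1 ∧ r' ≤ ENNReal.ofReal c * ENNReal.ofReal c := by
    have h0 : 0 < r'.toReal := ENNReal.toReal_pos (pos_of_gt hrr').ne' (hr'1.trans_le le_top).ne
    refine ⟨√r'.toReal, Real.sqrt_pos.2 h0, ?_, ?_⟩
    · rw [Real.sqrt_lt' one_pos, one_pow]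
      simpa using (ENNReal.toReal_lt_toReal (hr'1.trans_le le_top).ne ENNReal.one_ne_top).2 hr'1
    · rw [← ENNReal.ofReal_mul (Real.sqrt_nonneg _), Real.mul_self_sqrt h0.le,
        ENNReal.ofReal_toReal (hr'1.trans_le le_top).ne]
  obtain ⟨U, hUo, hU0, hUb, hUbal, hU⟩ := A.exists_nearly_invariant Λ hFs
    (fun g hg => (congrArg (fun f => |LinearMap.det f|) (hρ g)).trans (hdet' g hg)) hc0 hc1
  obtain ⟨𝒱, h𝒱, hU𝒱⟩ := LocalDeLeeuw.exists_basis_le_deltaBasis (F := F)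
    (ρ := LocalDeLeeuw.rescaled π) Λ hUo hU0 hUb hUbal
  refine hrr'.trans_le (le_trans ?_ (hU𝒱.trans (le_iSup₂_of_le 𝒱 h𝒱 le_rfl)))
  have hUpos : Λ U ≠ 0 := (hUo.measure_pos Λ ⟨0, hU0⟩).ne'
  rw [LocalDeLeeuw.deltaSet, ENNReal.le_div_iff_mul_le (Or.inl hUpos) (Or.inl hUb.measure_lt_top.ne)]
  calc r' * Λ U ≤ ENNReal.ofReal c * ENNReal.ofReal c * Λ U := by gcongr
    _ = ENNReal.ofReal c * (ENNReal.ofReal c * Λ U) := mul_assoc _ _ _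
    _ ≤ _ := hU
    _ = _ := by
      congr 1
      refine iInter₂_congr fun g _ => ?_
      rw [← hρ g]
      rfl
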